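/- Let $\mathcal H_{UV}$ be a finite-dimensional complex Hilbert space and $\mathcal H_{IR}\subset\mathcal H_{UV}$ a subspace. Let $\mathcal A_u$, $\mathcal A_r$ be von Neumann algebras on $\mathcal H_{UV}$, $\mathcal H_{IR}$, with commutants $\mathcal A_{\bar u}\subset\mathcal B(\mathcal H_{UV})$, $\mathcal A_{\bar r}\subset\mathcal B(\mathcal H_{IR})$, and let $A_{UV}$ be an operator in the center of $\mathcal A_u$. There are decompositions $$\mathcal H_{UV}=\bigoplus_\alpha\mathcal H_u^\alpha\otimes\mathcal H_{\bar u}^\alpha,\quad \mathcal A_u=\bigoplus_\alpha\mathcal B(\mathcal H_u^\alpha)\otimes 1,\qquad \mathcal H_{IR}=\bigoplus_\mu\mathcal H_r^\mu\otimes\mathcal H_{\bar r}^\mu,\quad \mathcal A_r=\bigoplus_\mu\mathcal B(\mathcal H_r^\mu)\otimes 1,$$ with nonzero factors. Fix any such decompositions. For a density operator $\rho$ on $\mathcal H_{IR}$ (also regarded as one on $\mathcal H_{UV}$, supported on $\mathcal H_{IR}$), let $\rho_u$, $\rho_{\bar u}$ be its reduced density operators on $\bigoplus_\alpha\mathcal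 H_u^\alpha$, $\bigoplus_\alpha\mathcal H_{\bar u}^\alpha$ and $\rho_r$, $\rho_{\bar r}$ those on $\bigoplus_\mu\mathcal H_r^\mu$, $\bigoplus_\mu\mathcal H_{\bar r}^\mu$ (block-diagonal partial traces); let $\langle A\rangle_\rho=\operatorname{tr}(\rho A)$ and $S(\sigma)=-\operatorname{tr}(\sigma\log\sigma)$. An algebra $\mathcal A$ on $\mathcal H_{IR}$ can be recovered from an algebra $\mathcal B$ on $\mathcal H_{UV}$ if for every $O\in\mathcal A$ there is $\tilde O\in\mathcal B$ with $O|\psi\rangle=\tilde O|\psi\rangle$ and $O^\dagger|\psi\rangle=\tilde O^\dagger|\psi\rangle$ for all $|\psi\rangle\in\mathcal H_{IR}$. Complementary recovery means that $\mathcal A_r$ can be recovered from $\mathcal A_u$ and $\mathcal A_{\bar r}$ from $\mathcal A_{\bar u}$. (1) Complementary recovery holds if and only if there is an operator $A_{IR}$ in the center of $\mathcal A_r$ such that, for every density operator $\rho$ on $\mathcal H_{IR}$, $$\langle A_{UV}\rangle_\rho+S(\rho_u)=\langle A_{IR}\rangle_\rho+S(\rho_r),\qquad \langle A_{UV}\rangle_\rho+S(\rho_{\bar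 u})=\langle A_{IR}\rangle_\rho+S(\rho_{\bar r}).$$ (2) If complementary recovery holds, then there are decompositions $$\mathcal H_u^\alpha=\Big(\bigoplus_\mu\mathcal H_r^\mu\otimes\mathcal H_o^{\alpha\mu}\Big)\oplus\mathcal H_{u,\mathrm{rest}}^\alpha,\qquad \mathcal H_{\bar u}^\alpha=\Big(\bigoplus_\mu\mathcal H_{\bar r}^\mu\otimes\mathcal H_{\bar o}^{\alpha\mu}\Big)\oplus\mathcal H_{\bar u,\mathrm{rest}}^\alpha$$ and unit vectors $|\chi^\mu\rangle\in\bigoplus_\alpha\mathcal H_o^{\alpha\mu}\otimes\mathcal H_{\bar o}^{\alpha\mu}$ such that the inclusion $\mathcal H_{IR}\subset\mathcal H_{UV}$ is $|i\rangle_r^\mu|j\rangle_{\bar r}^\mu\mapsto|i\rangle_r^\mu|\chi^\mu\rangle|j\rangle_{\bar r}^\mu$. (3) For any decompositions and vectors as in (2), there is exactly one operator $A_{IR}$ as in (1), namely $$A_{IR}=\bigoplus_\mu A_{IR}^\mu\,1^\mu,\qquad A_{IR}^\mu=S(\chi_o^\mu)+\langle\chi^\mu|A_{UV}|\chi^\mu\rangle,$$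 where $\chi_o^\mu$ is the reduced density operator of $|\chi^\mu\rangle\langle\chi^\mu|$ on $\bigoplus_\alpha\mathcal H_o^{\alpha\mu}$, and $A_{UV}$ acts on $\mathcal H_o^{\alpha\mu}\otimes\mathcal H_{\bar o}^{\alpha\mu}$ as the number by which it acts on the sector $\alpha$. -/

import Mathlib

open scoped InnerProductSpace

namespace HolographicRG

section General

variable {H : Type*} [NormedAddCommGroup H] [InnerProductSpace ℂ H] [CompleteSpace H]

/-- `a` belongs to the center of the von Neumann algebra `A`. -/
def IsCentral (A : VonNeumannAlgebra H) (a : H →L[ℂ] H) : Prop :=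
  a ∈ A ∧ ∀ b ∈ A, a * b = b * a

/-- Density operators: positive operators of trace one. -/
def IsDensity (ρ : H →L[ℂ] H) : Prop :=
  ρ.IsPositive ∧ LinearMap.trace ℂ H (ρ : H →ₗ[ℂ] H) = 1

/-- The expectation value `tr (ρ a)`. -/
noncomputable def expect (ρ a : H →L[ℂ] H) : ℂ :=
  LinearMap.trace ℂ H ((ρ * a : H →L[ℂ] H) : H →ₗ[ℂ] H)

/-- The von Neumann entropy `- tr (M log M) = - ∑ λ log λ` (with `0 log 0 = 0`) of a Hermitian
matrix, the sum running over the eigenvalues with multiplicity. It is only used for density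
matrices; non-Hermitian matrices get the value `0`. -/
noncomputable def entropy {ι : Type*} [Fintype ι] [DecidableEq ι] (M : Matrix ι ι ℂ) : ℝ :=
  open Classical in
  if h : M.IsHermitian then ∑ i, Real.negMulLog (h.eigenvalues i) else 0

/-- A decomposition `H = ⨁ α, L α ⊗ R α` with `A = ⨁ α, B(L α) ⊗ 1`, where `L α` and `R α`
are Hilbert spaces of the positive dimensions `dimL α` and `dimR α` with chosen orthonormal bases,
so that `basis ⟨α, (i, j)⟩` is the vector `|i⟩ ⊗ |j⟩` of the sector `α`. -/
structure SectorDecomposition (A : VonNeumannAlgebra H) where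
  /-- the number of sectors -/
  n : ℕ
  /-- the dimension of the factor on which `A` acts -/
  dimL : Fin n → ℕ
  /-- the dimension of the factor on which the commutant acts -/
  dimR : Fin n → ℕ
  dimL_pos : ∀ α, 0 < dimL α
  dimR_pos : ∀ α, 0 < dimR α
  basis : OrthonormalBasis (Σ α : Fin n, Fin (dimL α) × Fin (dimR α)) ℂ H
  mem_iff : ∀ a : H →L[ℂ] H, a ∈ A ↔
    ∃ M : ∀ α, Matrix (Fin (dimL α)) (Fin (dimL α)) ℂ,
      ∀ α i j, a (basis ⟨α, (i, j)⟩) = ∑ k, M α k i • basis ⟨α, (k, j)⟩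

namespace SectorDecomposition

variable {A : VonNeumannAlgebra H} (d : SectorDecomposition A)

/-- The reduced state of `ρ` with respect to `A`: the block diagonal matrix on `⨁ α, L α` whose
block `α` is the partial trace over `R α` of the block `α` of `ρ`. -/
noncomputable def reducedL (ρ : H →L[ℂ] H) :
    Matrix (Σ α, Fin (d.dimL α)) (Σ α, Fin (d.dimL α)) ℂ :=
  Matrix.blockDiagonal' fun α => Matrix.of fun i k =>
    ∑ j, ⟪d.basis ⟨α, (i, j)⟩, ρ (d.basis ⟨α, (k, j)⟩)⟫_ℂ

/-- The reduced state of `ρ` with respect to the commutant of `A`, i.e. `⨁ α, 1 ⊗ B(R α)`. -/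
noncomputable def reducedR (ρ : H →L[ℂ] H) :
    Matrix (Σ α, Fin (d.dimR α)) (Σ α, Fin (d.dimR α)) ℂ :=
  Matrix.blockDiagonal' fun α => Matrix.of fun j l =>
    ∑ i, ⟪d.basis ⟨α, (i, j)⟩, ρ (d.basis ⟨α, (i, l)⟩)⟫_ℂ

/-- The product vector `v ⊗ w` in the sector `α`. -/
noncomputable def tmul (α : Fin d.n) (v : EuclideanSpace ℂ (Fin (d.dimL α)))
    (w : EuclideanSpace ℂ (Fin (d.dimR α))) : H :=
  ∑ i, ∑ j, (v i * w j) • d.basis ⟨α, (i, j)⟩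

/-- The operator `⨁ α, c α • 1`. -/
noncomputable def blockScalar (c : Fin d.n → ℂ) : H →L[ℂ] H :=
  ∑ x, c x.1 • InnerProductSpace.rankOne ℂ (d.basis x) (d.basis x)

/-- The number by which a central element of `A` acts on the sector `α` (read off from one
basis vector of that sector). -/
noncomputable def sectorValue (a : H →L[ℂ] H) (α : Fin d.n) : ℂ :=
  ⟪d.basis ⟨α, (⟨0, d.dimL_pos α⟩, ⟨0, d.dimR_pos α⟩)⟩,
    a (d.basis ⟨α, (⟨0, d.dimL_pos α⟩, ⟨0, d.dimR_pos α⟩)⟩)⟫_ℂ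

end SectorDecomposition

end General

section Code

variable {H : Type*} [NormedAddCommGroup H] [InnerProductSpace ℂ H] [CompleteSpace H]
  [FiniteDimensional ℂ H]

/-- `A` (on the subspace `K`) can be recovered from `B` (on `H`): every operator of `A` is
represented on `K`, together with its adjoint, by an operator of `B`. -/
def Recoverable {K : Submodule ℂ H} (A : VonNeumannAlgebra K) (B : VonNeumannAlgebra H) : Prop :=
  ∀ a ∈ A, ∃ b ∈ B, ∀ ψ : K, ((a ψ : K) : H) = b ψ ∧ ((star a ψ : K) : H) = star b ψ

/-- `Ar` is recoverable from `Au`, and the commutant of `Ar` from the commutant of `Au`. -/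
def ComplementaryRecovery {K : Submodule ℂ H} (Au : VonNeumannAlgebra H)
    (Ar : VonNeumannAlgebra K) : Prop :=
  Recoverable Ar Au ∧ Recoverable Ar.commutant Au.commutant

/-- An operator on the subspace `K` regarded as an operator on `H` (zero on `Kᗮ`). -/
noncomputable def extend {K : Submodule ℂ H} (ρ : K →L[ℂ] K) : H →L[ℂ] H :=
  K.subtypeL ∘L ρ ∘L K.orthogonalProjectionOnto

variable {K : Submodule ℂ H} {Au : VonNeumannAlgebra H} {Ar : VonNeumannAlgebra K}

/-- For every density operator `ρ` on `K`,
`⟨AUV⟩ + S(ρ_u) = ⟨AIR⟩ + S(ρ_r)`, and the same for the two commutants. -/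
def EntropyBalance (dU : SectorDecomposition Au) (dR : SectorDecomposition Ar)
    (AUV : H →L[ℂ] H) (AIR : K →L[ℂ] K) : Prop :=
  ∀ ρ : K →L[ℂ] K, IsDensity ρ →
    expect (extend ρ) AUV + (entropy (dU.reducedL (extend ρ)) : ℂ) =
        expect ρ AIR + (entropy (dR.reducedL ρ) : ℂ) ∧
    expect (extend ρ) AUV + (entropy (dU.reducedR (extend ρ)) : ℂ) =
        expect ρ AIR + (entropy (dR.reducedR ρ) : ℂ)

/-- Decompositions `L_α = (⨁ μ, L_μ ⊗ O_αμ) ⊕ rest`, `R_α = (⨁ μ, R_μ ⊗ O'_αμ) ⊕ rest` of the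
factors of the sectors of `H`, and unit vectors `χ μ` in `⨁ α, O_αμ ⊗ O'_αμ`, such that the
inclusion of `K = ⨁ μ, L_μ ⊗ R_μ` into `H` sends `|i⟩|j⟩` to `|i⟩ (χ μ) |j⟩`. -/
structure CodeDecomposition (dU : SectorDecomposition Au) (dR : SectorDecomposition Ar) where
  /-- the dimension of `O_αμ` -/
  dimO : Fin dU.n → Fin dR.n → ℕ
  /-- the dimension of `O'_αμ` -/
  dimO' : Fin dU.n → Fin dR.n → ℕ
  /-- `inL α ⟨μ, (i, k)⟩` is the vector `|i⟩ ⊗ |k⟩` of `L_μ ⊗ O_αμ`, inside `L_α` -/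
  inL : ∀ α, (Σ μ, Fin (dR.dimL μ) × Fin (dimO α μ)) → EuclideanSpace ℂ (Fin (dU.dimL α))
  inL_orthonormal : ∀ α, Orthonormal ℂ (inL α)
  /-- `inR α ⟨μ, (j, l)⟩` is the vector `|j⟩ ⊗ |l⟩` of `R_μ ⊗ O'_αμ`, inside `R_α` -/
  inR : ∀ α, (Σ μ, Fin (dR.dimR μ) × Fin (dimO' α μ)) → EuclideanSpace ℂ (Fin (dU.dimR α))
  inR_orthonormal : ∀ α, Orthonormal ℂ (inR α)
  χ : ∀ μ, EuclideanSpace ℂ (Σ α, Fin (dimO α μ) × Fin (dimO' α μ))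
  norm_χ : ∀ μ, ‖χ μ‖ = 1
  embed : ∀ μ i j, ((dR.basis ⟨μ, (i, j)⟩ : K) : H) =
    ∑ α, ∑ k, ∑ l, χ μ ⟨α, (k, l)⟩ • dU.tmul α (inL α ⟨μ, (i, k)⟩) (inR α ⟨μ, (j, l)⟩)

namespace CodeDecomposition

variable {dU : SectorDecomposition Au} {dR : SectorDecomposition Ar} (D : CodeDecomposition dU dR)

/-- The reduced state of `|χ μ⟩⟨χ μ|` with respect to `⨁ α, B(O_αμ)`. -/
noncomputable def χo (μ : Fin dR.n) :
    Matrix (Σ α, Fin (D.dimO α μ)) (Σ α, Fin (D.dimO α μ)) ℂ :=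
  Matrix.blockDiagonal' fun α => Matrix.of fun k k' =>
    ∑ l, D.χ μ ⟨α, (k, l)⟩ * star (D.χ μ ⟨α, (k', l)⟩)

/-- `⟨χ μ| AUV |χ μ⟩`, where the central operator `AUV` acts on `O_αμ ⊗ O'_αμ` as the number
by which it acts on the sector `α`. -/
noncomputable def χExpect (AUV : H →L[ℂ] H) (μ : Fin dR.n) : ℂ :=
  ∑ x, star (D.χ μ x) * dU.sectorValue AUV x.1 * D.χ μ x

/-- `⨁ μ, (S(χ_o μ) + ⟨χ μ| AUV |χ μ⟩) • 1`. -/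
noncomputable def areaIR (AUV : H →L[ℂ] H) : K →L[ℂ] K :=
  dR.blockScalar fun μ => (entropy (D.χo μ) : ℂ) + D.χExpect AUV μ

end CodeDecomposition

end Code

end HolographicRG

namespace HolographicRG

open Matrix

/-! ### Entropy of matrices: spectral invariance and strict concavity -/

section Entropy

open scoped ComplexOrder

variable {ι κ : Type*} [Fintype ι] [DecidableEq ι] [Fintype κ] [DecidableEq κ]

/-! Recovery has a bilinear reformulation (`recoverable_iff`): an algebra on the code space `K` is
recoverable from `B` exactly when compressing the commutant of `B` to `K` yields operators commuting
with that algebra. Both directions of the equivalence rest on it.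

From balance to recovery, let `τ` be a self-adjoint operator on `K` that is invisible to `Ar`.
Moving the maximally mixed state along `τ` changes neither `ρ_r` nor its entropy, and expectation
values are affine, so balance makes `S(ρ_u)` affine along the segment. Strict concavity of the
entropy then forces `ρ_u` to be constant, so `τ` is invisible to `Au` as well. Applied, after
complexification, to differences of rank-one operators built from an element of the commutant of
`Ar`, this is the bilinear criterion for the commutants. The second balance equation gives the
recovery of `Ar` itself.

From recovery to structure, the criterion says that the slices in `L_α` of the code basis vectors
have a Gram matrix of the form `1 ⊗ N`, hence factor as `|i⟩` times a vector independent of `i`. The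
commutants give the same on the `R_α` side. The coefficients of the joint expansion depend neither
on `i` nor on `j`, and they form `χ μ`.

From structure to balance, `ρ_u` in sector `α` is an isometric image of `⨁ μ, ρ_r^μ ⊗ χ_α^μ`. Its
eigenvalues are products, and the logarithm of a product splits off exactly the area term. The
commutant equation follows by exchanging factors, since both reductions of `χ μ` have equal entropy.
Expectation values in all states determine an operator, which gives uniqueness. The sector
decompositions themselves come from an orthogonal family of irreducible subspaces, Schur's lemma and
the double commutant property. -/

theorem entropy_eq_sum_roots {M : Matrix ι ι ℂ} (hM : M.IsHermitian) :
    entropy M = (M.charpoly.roots.map fun z => Real.negMulLog z.re).sum := by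
  rw [entropy, dif_pos hM, hM.roots_charpoly_eq_eigenvalues, Multiset.map_map]
  rfl

/-- The characteristic polynomials of the two products agree up to powers of `X`, so the spectra
differ only in zeros, which contribute `0 log 0 = 0`. Hermiticity is needed on both sides because
`entropy` takes the default value `0` elsewhere. -/
theorem entropy_mul_comm (A : Matrix ι κ ℂ) (B : Matrix κ ι ℂ) (hAB : (A * B).IsHermitian)
    (hBA : (B * A).IsHermitian) : entropy (A * B) = entropy (B * A) := by
  rw [entropy_eq_sum_roots hAB, entropy_eq_sum_roots hBA]
  have h := congrArg Polynomial.roots (Matrix.charpoly_mul_comm' A B)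
  rw [Polynomial.roots_mul, Polynomial.roots_mul, Polynomial.roots_X_pow,
    Polynomial.roots_X_pow] at h
  · have h' := congrArg (fun s => (s.map fun z : ℂ => Real.negMulLog z.re).sum) h
    simpa [Multiset.map_nsmul, Multiset.sum_nsmul] using h'
  · exact mul_ne_zero (pow_ne_zero _ Polynomial.X_ne_zero) (charpoly_monic _).ne_zero
  · exact mul_ne_zero (pow_ne_zero _ Polynomial.X_ne_zero) (charpoly_monic _).ne_zero

theorem entropy_transpose {M : Matrix ι ι ℂ} (hM : M.IsHermitian) :
    entropy Mᵀ = entropy M := by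
  rw [entropy_eq_sum_roots hM, entropy_eq_sum_roots hM.transpose, charpoly_transpose]

theorem entropy_diagonal (d : ι → ℝ) :
    entropy (diagonal fun i => (d i : ℂ)) = ∑ i, Real.negMulLog (d i) := by
  rw [entropy_eq_sum_roots (isHermitian_diagonal_of_self_adjoint _ (by ext; simp)),
    charpoly_diagonal, Polynomial.roots_prod _ _ (Finset.prod_ne_zero_iff.2 fun i _ =>
      Polynomial.X_sub_C_ne_zero _)]
  simp [Multiset.bind_singleton]

theorem entropy_isometry_conj (W : Matrix ι κ ℂ) (hW : Wᴴ * W = 1) (d : κ → ℝ) :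
    entropy (W * diagonal (fun i => (d i : ℂ)) * Wᴴ) = ∑ i, Real.negMulLog (d i) := by
  have hd : (diagonal fun i => (d i : ℂ)).IsHermitian :=
    isHermitian_diagonal_of_self_adjoint _ (by ext; simp)
  have h : Wᴴ * (W * diagonal fun i => (d i : ℂ)) = diagonal fun i => (d i : ℂ) := by
    rw [← Matrix.mul_assoc, hW, Matrix.one_mul]
  rw [entropy_mul_comm _ _ (isHermitian_mul_mul_conjTranspose W hd) (by rw [h]; exact hd), h,
    entropy_diagonal]

theorem exists_eq_conj_diagonal {M : Matrix ι ι ℂ} (hM : M.IsHermitian) :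
    ∃ (U : Matrix ι ι ℂ) (d : ι → ℝ), Uᴴ * U = 1 ∧ U * Uᴴ = 1 ∧
      M = U * diagonal (fun i => (d i : ℂ)) * Uᴴ ∧ d = hM.eigenvalues := by
  refine ⟨hM.eigenvectorUnitary, hM.eigenvalues, ?_, ?_, ?_, rfl⟩
  · exact Unitary.coe_star_mul_self _
  · exact Unitary.coe_mul_star_self _
  · conv_lhs => rw [hM.spectral_theorem, Unitary.conjStarAlgAut_apply]
    rfl

omit [Fintype ι] [DecidableEq ι] in
theorem conj_diagonal_apply (U : Matrix ι κ ℂ) (d : κ → ℂ) (i k : ι) :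
    (U * diagonal d * Uᴴ) i k = ∑ j, U i j * d j * star (U k j) := by
  simp [Matrix.mul_apply, diagonal_apply]

theorem sum_normSq_row {U : Matrix ι ι ℂ} (hU : U * Uᴴ = 1) (i : ι) :
    ∑ j, ‖U i j‖ ^ 2 = 1 := by
  have h := congrFun (congrFun hU i) i
  rw [Matrix.mul_apply, one_apply_eq] at h
  have h' : ((∑ j, ‖U i j‖ ^ 2 : ℝ) : ℂ) = 1 := by
    rw [← h]; push_cast
    refine Finset.sum_congr rfl fun j _ => ?_
    rw [conjTranspose_apply, RCLike.star_def, Complex.mul_conj, Complex.normSq_eq_norm_sq]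
    push_cast; rfl
  exact_mod_cast h'

theorem sum_normSq_col {U : Matrix ι ι ℂ} (hU : Uᴴ * U = 1) (j : ι) :
    ∑ i, ‖U i j‖ ^ 2 = 1 := by
  have := sum_normSq_row (U := Uᴴ) (by rwa [conjTranspose_conjTranspose]) j
  simpa using this

/-- Peierls' inequality for the entropy, with its equality case. -/
theorem entropy_le_sum_diag {M : Matrix ι ι ℂ} (hM : M.PosSemidef) :
    entropy M ≤ ∑ i, Real.negMulLog (M i i).re ∧
      (entropy M = ∑ i, Real.negMulLog (M i i).re → M = diagonal fun i => M i i) := by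
  obtain ⟨U, d, hU, hU', hMU, hd⟩ := exists_eq_conj_diagonal hM.1
  have hd0 : ∀ i, d i ∈ Set.Ici (0 : ℝ) := fun i => by
    rw [hd]; exact hM.eigenvalues_nonneg i
  have hent : entropy M = ∑ i, ∑ j, ‖U i j‖ ^ 2 • Real.negMulLog (d j) := by
    rw [Finset.sum_comm]
    simp_rw [← Finset.sum_smul, sum_normSq_col hU, one_smul]
    rw [hMU, entropy_isometry_conj U hU]
  -- Each diagonal entry is an average of the eigenvalues, with weights from a row of a unitary
  -- matrix, so Jensen's inequality applies entrywise.
  have hdiag : ∀ i, M i i = ((∑ j, ‖U i j‖ ^ 2 • d j : ℝ) : ℂ) := fun i => by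
    conv_lhs => rw [hMU]
    rw [conj_diagonal_apply]
    push_cast
    refine Finset.sum_congr rfl fun j _ => ?_
    rw [mul_right_comm, RCLike.star_def, Complex.mul_conj, Complex.normSq_eq_norm_sq, smul_eq_mul]
    push_cast; rfl
  have hle : ∀ i, ∑ j, ‖U i j‖ ^ 2 • Real.negMulLog (d j) ≤ Real.negMulLog (M i i).re := fun i => by
    rw [hdiag, Complex.ofReal_re]
    exact Real.strictConcaveOn_negMulLog.concaveOn.le_map_sum (fun _ _ => by positivity)
      (sum_normSq_row hU' i) fun j _ => hd0 j
  refine ⟨hent ▸ Finset.sum_le_sum fun i _ => hle i, fun heq => ?_⟩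
  rw [hent, Finset.sum_eq_sum_iff_of_le fun i _ => hle i] at heq
  ext i k
  have hi := heq i (Finset.mem_univ i)
  rw [hdiag, Complex.ofReal_re] at hi
  -- Equality in Jensen makes every eigenvalue of nonzero weight in row `i` equal to `M i i`; hence
  -- row `i` of `M` is `M i i` times that row of `U * Uᴴ = 1`.
  have hj := (Real.strictConcaveOn_negMulLog.map_sum_eq_iff' (fun _ _ => by positivity)
    (sum_normSq_row hU' i) fun j _ => hd0 j).1 hi.symm
  have hrow : ∀ j, U i j * (d j : ℂ) = M i i * U i j := fun j => by
    by_cases h0 : U i j = 0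
    · simp [h0]
    · rw [hdiag, ← hj j (Finset.mem_univ j) (by simpa using h0), mul_comm]
  have hik : M i k = M i i * (U * Uᴴ) i k := by
    conv_lhs => rw [hMU, conj_diagonal_apply]
    simp_rw [hrow, mul_assoc, ← Finset.mul_sum]
    rfl
  rw [hik, hU', one_apply, diagonal_apply, mul_ite, mul_one, mul_zero]

/-- Strict midpoint concavity of the entropy. -/
theorem eq_of_entropy_midpoint {A B : Matrix ι ι ℂ} (hA : A.PosSemidef) (hB : B.PosSemidef)
    (h : 2 * entropy ((1 / 2 : ℂ) • (A + B)) = entropy A + entropy B) : A = B := by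
  have hC : ((1 / 2 : ℂ) • (A + B)).IsHermitian := by
    rw [IsHermitian, conjTranspose_smul, conjTranspose_add, hA.1, hB.1]; simp
  -- Everything is compared in an eigenbasis of the midpoint, where its entropy is read off the
  -- diagonal.
  obtain ⟨V, s, hV, hV', hCV, -⟩ := exists_eq_conj_diagonal hC
  have hconj : ∀ X : Matrix ι ι ℂ, X.PosSemidef → (Vᴴ * X * V).PosSemidef ∧
      entropy (Vᴴ * X * V) = entropy X := fun X hX => by
    have h1 := hX.conjTranspose_mul_mul_same V
    refine ⟨h1, ?_⟩
    have h2 : V * (Vᴴ * X) = X := by rw [← Matrix.mul_assoc, hV', Matrix.one_mul]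
    rw [entropy_mul_comm _ _ h1.1 (by rw [h2]; exact hX.1), h2]
  obtain ⟨hA1, hA2⟩ := hconj A hA
  obtain ⟨hB1, hB2⟩ := hconj B hB
  have hsum : (1 / 2 : ℂ) • (Vᴴ * A * V + Vᴴ * B * V) = diagonal fun i => (s i : ℂ) := by
    calc (1 / 2 : ℂ) • (Vᴴ * A * V + Vᴴ * B * V) = Vᴴ * ((1 / 2 : ℂ) • (A + B)) * V := by
          simp [Matrix.mul_add, Matrix.add_mul]
      _ = (Vᴴ * V) * (diagonal fun i => (s i : ℂ)) * (Vᴴ * V) := by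
          rw [hCV]; simp only [Matrix.mul_assoc]
      _ = _ := by rw [hV, Matrix.one_mul, Matrix.mul_one]
  set A' := Vᴴ * A * V
  set B' := Vᴴ * B * V
  have hs : ∀ i, s i = (1 / 2 : ℝ) • (A' i i).re + (1 / 2 : ℝ) • (B' i i).re := fun i => by
    have := congrArg Complex.re (congrFun (congrFun hsum i) i)
    simp at this
    simp only [smul_eq_mul]
    linarith
  have hnn : ∀ X : Matrix ι ι ℂ, X.PosSemidef → ∀ i, (X i i).re ∈ Set.Ici (0 : ℝ) :=
    fun X hX i => (Complex.le_def.1 (hX.diag_nonneg (i := i))).1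
  have hent : entropy ((1 / 2 : ℂ) • (A + B)) = ∑ i, Real.negMulLog (s i) := by
    rw [hCV, entropy_isometry_conj V hV]
  have hle : ∀ i, (Real.negMulLog (A' i i).re + Real.negMulLog (B' i i).re) / 2 ≤
      Real.negMulLog (s i) := fun i => by
    have := Real.strictConcaveOn_negMulLog.concaveOn.2 (hnn A' hA1 i) (hnn B' hB1 i)
      (by norm_num : (0 : ℝ) ≤ 1 / 2) (by norm_num : (0 : ℝ) ≤ 1 / 2) (by norm_num)
    rw [← hs] at this
    simp only [smul_eq_mul] at this
    linarith
  have hA3 := entropy_le_sum_diag hA1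
  have hB3 := entropy_le_sum_diag hB1
  rw [hA2] at hA3
  rw [hB2] at hB3
  have hsumle := Finset.sum_le_sum fun i (_ : i ∈ Finset.univ) => hle i
  have hsplit : ∑ i, (Real.negMulLog (A' i i).re + Real.negMulLog (B' i i).re) / 2 =
      (∑ i, Real.negMulLog (A' i i).re + ∑ i, Real.negMulLog (B' i i).re) / 2 := by
    rw [← Finset.sum_add_distrib, Finset.sum_div]
  rw [hent] at h
  -- The hypothesis closes the chain `S(A) + S(B)` ≤ entropies of the two diagonals ≤ `2
  -- S(midpoint)`. So Peierls' inequality is sharp and `A'`, `B'` are diagonal; scalar strict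
  -- concavity then identifies their diagonals.
  have hAd := hA3.2 (by linarith [hA3.1, hB3.1])
  have hBd := hB3.2 (by linarith [hA3.1, hB3.1])
  have heq : ∑ i, (Real.negMulLog (A' i i).re + Real.negMulLog (B' i i).re) / 2 =
      ∑ i, Real.negMulLog (s i) := by linarith [hA3.1, hB3.1]
  rw [Finset.sum_eq_sum_iff_of_le fun i _ => hle i] at heq
  have hii : ∀ i, (A' i i).re = (B' i i).re := fun i => by
    by_contra hne
    have h1 := Real.strictConcaveOn_negMulLog.2 (hnn A' hA1 i) (hnn B' hB1 i) hne
      (by norm_num : (0 : ℝ) < 1 / 2) (by norm_num : (0 : ℝ) < 1 / 2) (by norm_num)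
    rw [← hs] at h1
    have h2 := heq i (Finset.mem_univ i)
    simp only [smul_eq_mul] at h1
    linarith
  have hAB : A' = B' := by
    rw [hAd, hBd]
    congr 1
    ext i
    have him : ∀ X : Matrix ι ι ℂ, X.PosSemidef → (X i i).im = 0 :=
      fun X hX => (Complex.le_def.1 (hX.diag_nonneg (i := i))).2.symm
    exact Complex.ext (hii i) ((him A' hA1).trans (him B' hB1).symm)
  have hback : ∀ X : Matrix ι ι ℂ, X = V * (Vᴴ * X * V) * Vᴴ := fun X => by
    calc X = (V * Vᴴ) * X * (V * Vᴴ) := by rw [hV', Matrix.one_mul, Matrix.mul_one]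
      _ = _ := by simp only [Matrix.mul_assoc]
  rw [hback A, hback B]
  exact congrArg (fun X => V * X * Vᴴ) hAB

end Entropy

/-! ### Irreducible invariant subspaces, Schur's lemma and unitary intertwiners -/

section Irreducible

variable {H : Type*} [NormedAddCommGroup H] [InnerProductSpace ℂ H] [CompleteSpace H]

/-- `W` is invariant under the algebra `A`. -/
def IsInvariant (A : VonNeumannAlgebra H) (W : Submodule ℂ H) : Prop :=
  ∀ a ∈ A, ∀ w ∈ W, a w ∈ W

/-- `W` is a minimal nonzero invariant subspace of `A`. -/
def IsIrreducible (A : VonNeumannAlgebra H) (W : Submodule ℂ H) : Prop :=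
  IsInvariant A W ∧ W ≠ ⊥ ∧ ∀ V ≤ W, IsInvariant A V → V ≠ ⊥ → V = W

/-- `U` intertwines the representations of `A` on `V` and `W` unitarily. -/
def IsIntertwiner (A : VonNeumannAlgebra H) (V W : Submodule ℂ H) (U : H →L[ℂ] H) : Prop :=
  U ∈ A.commutant ∧ (∀ v ∈ V, U v ∈ W) ∧ (∀ v ∈ V, ∀ v' ∈ V, ⟪U v, U v'⟫_ℂ = ⟪v, v'⟫_ℂ) ∧
    ∀ w ∈ W, ∃ v ∈ V, U v = w

variable {A : VonNeumannAlgebra H} {V W : Submodule ℂ H}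

theorem IsInvariant.orthogonal (hW : IsInvariant A W) : IsInvariant A Wᗮ := by
  intro a ha x hx
  rw [Submodule.mem_orthogonal] at hx ⊢
  intro w hw
  rw [← ContinuousLinearMap.adjoint_inner_left]
  exact hx _ (hW _ (star_mem ha) w hw)

theorem commute_apply {a x : H →L[ℂ] H} (ha : a ∈ A) (hx : x ∈ A.commutant) (v : H) :
    a (x v) = x (a v) :=
  congrArg (fun f : H →L[ℂ] H => f v) (VonNeumannAlgebra.mem_commutant_iff.1 hx a ha)

theorem smul_mem_algebra {a : H →L[ℂ] H} (c : ℂ) (ha : a ∈ A) : c • a ∈ A :=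
  A.toStarSubalgebra.smul_mem ha c

variable [FiniteDimensional ℂ H]

theorem IsInvariant.starProjection_mem (hW : IsInvariant A W) :
    W.starProjection ∈ A.commutant := by
  rw [VonNeumannAlgebra.mem_commutant_iff]
  intro a ha
  ext v
  have h1 : a (W.starProjection v) ∈ W := hW a ha _ (W.starProjection_apply_mem v)
  have h2 : a (v - W.starProjection v) ∈ Wᗮ :=
    hW.orthogonal a ha _ (W.sub_starProjection_mem_orthogonal v)
  refine (Submodule.eq_starProjection_of_mem_orthogonal h1 ?_).symm
  rw [map_sub] at h2
  exact h2

theorem IsInvariant.exists_irreducible_le (hW : IsInvariant A W) (h0 : W ≠ ⊥) :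
    ∃ V ≤ W, IsIrreducible A V := by
  obtain ⟨V, ⟨hVW, hV, hV0⟩, hmin⟩ := (wellFounded_lt (α := Submodule ℂ H)).has_min
    {V | V ≤ W ∧ IsInvariant A V ∧ V ≠ ⊥} ⟨W, le_rfl, hW, h0⟩
  refine ⟨V, hVW, hV, hV0, fun V' hle hV' hV'0 => ?_⟩
  by_contra hne
  exact hmin V' ⟨hle.trans hVW, hV', hV'0⟩ (lt_of_le_of_ne hle hne)

/-- Schur's lemma. -/
theorem IsIrreducible.exists_scalar (hW : IsIrreducible A W) {x : H →L[ℂ] H}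
    (hx : x ∈ A.commutant) (hxW : ∀ w ∈ W, x w ∈ W) : ∃ c : ℂ, ∀ w ∈ W, x w = c • w := by
  have : Nontrivial W := Submodule.nontrivial_iff_ne_bot.2 hW.2.1
  obtain ⟨c, hc⟩ := Module.End.exists_eigenvalue ((x : H →ₗ[ℂ] H).restrict hxW)
  obtain ⟨w, hw⟩ := hc.exists_hasEigenvector
  have hxw : x w = c • (w : H) := congrArg Subtype.val hw.apply_eq_smul
  refine ⟨c, ?_⟩
  -- The eigenspace of `x` inside `W` is invariant because `x` commutes with `A`; it is nonzero, so
  -- minimality makes it all of `W`.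
  have hle : W ⊓ LinearMap.ker ((x : H →ₗ[ℂ] H) - c • LinearMap.id) = W := by
    refine hW.2.2 _ inf_le_left (fun a ha v hv => ⟨hW.1 a ha v hv.1, ?_⟩) fun h => ?_
    · have h2 : x v = c • v := by simpa [sub_eq_zero] using hv.2
      have : x (a v) = c • a v := by rw [← commute_apply ha hx, h2, map_smul]
      simpa [sub_eq_zero] using this
    · have hmem : (w : H) ∈ W ⊓ LinearMap.ker ((x : H →ₗ[ℂ] H) - c • LinearMap.id) :=
        ⟨w.2, by simpa [sub_eq_zero] using hxw⟩
      rw [h, Submodule.mem_bot] at hmem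
      exact hw.2 (Subtype.ext hmem)
  intro v hv
  rw [← hle] at hv
  simpa [sub_eq_zero] using hv.2

/-- Put `T = P_W x`. By Schur, the compression of `star T * T` to `V` is a scalar, so `T` is a
multiple of an isometry on `V`. The multiple is nonzero as `T v ≠ 0`, and the image is a nonzero
invariant subspace of `W`, hence `W`. Thus inequivalent irreducibles are not linked by the
commutant. -/
theorem IsIrreducible.exists_intertwiner (hV : IsIrreducible A V) (hW : IsIrreducible A W)
    {x : H →L[ℂ] H} (hx : x ∈ A.commutant) {v : H} (hv : v ∈ V)
    (hne : W.starProjection (x v) ≠ 0) : ∃ U, IsIntertwiner A V W U := by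
  set T : H →L[ℂ] H := W.starProjection * x with hT
  have hTmem : T ∈ A.commutant := mul_mem hW.1.starProjection_mem hx
  have hTW : ∀ u, T u ∈ W := fun u => W.starProjection_apply_mem _
  obtain ⟨c, hc⟩ := hV.exists_scalar (x := V.starProjection * (star T * T))
    (mul_mem hV.1.starProjection_mem (mul_mem (star_mem hTmem) hTmem))
    fun w _ => V.starProjection_apply_mem _
  have hinner : ∀ u ∈ V, ∀ u' ∈ V, ⟪T u, T u'⟫_ℂ = c * ⟪u, u'⟫_ℂ := fun u hu u' hu' => by
    rw [← inner_smul_right, ← hc u' hu']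
    change _ = ⟪u, V.starProjection (star T (T u'))⟫_ℂ
    rw [← Submodule.inner_starProjection_left_eq_right,
      (Submodule.starProjection_eq_self_iff).2 hu, ContinuousLinearMap.star_eq_adjoint,
      ContinuousLinearMap.adjoint_inner_right]
  have hTv : T v ≠ 0 := hne
  have hv0 : v ≠ 0 := fun h => hTv (by rw [h, map_zero])
  have hcr : c = ((‖T v‖ ^ 2 / ‖v‖ ^ 2 : ℝ) : ℂ) := by
    have h := hinner v hv v hv
    rw [inner_self_eq_norm_sq_to_K, inner_self_eq_norm_sq_to_K] at h
    have : ((‖v‖ : ℂ)) ^ 2 ≠ 0 := pow_ne_zero _ (by simpa using hv0)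
    push_cast
    rw [eq_div_iff this]
    exact h.symm
  set r : ℝ := ‖T v‖ ^ 2 / ‖v‖ ^ 2 with hr
  have hrpos : 0 < r := by positivity
  set s : ℂ := (((Real.sqrt r)⁻¹ : ℝ) : ℂ) with hs
  have hs0 : s ≠ 0 := by
    rw [hs]; exact_mod_cast (inv_pos.2 (Real.sqrt_pos.2 hrpos)).ne'
  have hss : s * s * c = 1 := by
    rw [hcr, hs, ← Complex.ofReal_mul, ← Complex.ofReal_mul, ← mul_inv,
      Real.mul_self_sqrt hrpos.le, inv_mul_cancel₀ hrpos.ne', Complex.ofReal_one]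
  refine ⟨s • T, smul_mem_algebra s hTmem, fun u _ => W.smul_mem s (hTW u),
    fun u hu u' hu' => ?_, ?_⟩
  · rw [_root_.smul_apply, _root_.smul_apply, inner_smul_left,
      inner_smul_right, hinner u hu u' hu', hs, Complex.conj_ofReal, ← hs, ← mul_assoc,
      ← mul_assoc, hss, one_mul]
  · have hmap : V.map (T : H →ₗ[ℂ] H) = W := by
      refine hW.2.2 _ ?_ ?_ ?_
      · rintro _ ⟨u, -, rfl⟩
        exact hTW u
      · rintro a ha _ ⟨u, hu, rfl⟩
        exact ⟨a u, hV.1 a ha u hu, (commute_apply ha hTmem u).symm⟩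
      · intro h
        have : T v ∈ V.map (T : H →ₗ[ℂ] H) := ⟨v, hv, rfl⟩
        rw [h, Submodule.mem_bot] at this
        exact hTv this
    intro w hw
    rw [← hmap] at hw
    obtain ⟨u, hu, rfl⟩ := hw
    refine ⟨s⁻¹ • u, V.smul_mem _ hu, ?_⟩
    rw [_root_.smul_apply, map_smul, smul_smul, mul_inv_cancel₀ hs0, one_smul]
    rfl

/-- The adjoint of `U` also lies in the commutant, and its component from `W` to `V` is nonzero
because `⟨v, star U (U v)⟩ = ⟨v, v⟩`. -/
theorem IsIntertwiner.exists_symm (hV : IsIrreducible A V) (hW : IsIrreducible A W)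
    {U : H →L[ℂ] H} (hU : IsIntertwiner A V W U) : ∃ U', IsIntertwiner A W V U' := by
  obtain ⟨v, hv, hv0⟩ := Submodule.exists_mem_ne_zero_of_ne_bot hV.2.1
  refine hW.exists_intertwiner hV (star_mem hU.1) (hU.2.1 v hv) fun h => hv0 ?_
  have h2 : ⟪v, V.starProjection (star U (U v))⟫_ℂ = ⟪v, v⟫_ℂ := by
    rw [← Submodule.inner_starProjection_left_eq_right,
      (Submodule.starProjection_eq_self_iff).2 hv, ContinuousLinearMap.star_eq_adjoint,
      ContinuousLinearMap.adjoint_inner_right, hU.2.2.1 v hv v hv]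
  rw [h, inner_zero_right] at h2
  exact inner_self_eq_zero.1 h2.symm

-- A maximal orthogonal family exists by Zorn; the orthogonal complement of its span is invariant,
-- and if nonzero it would contain one more irreducible.
variable (A) in
theorem exists_orthogonal_irreducibles : ∃ S : Set (Submodule ℂ H),
    (∀ W ∈ S, IsIrreducible A W) ∧ S.Pairwise (· ⟂ ·) ∧ sSup S = ⊤ := by
  obtain ⟨S, ⟨hS, hpair⟩, hmax⟩ := zorn_subset
    {S : Set (Submodule ℂ H) | (∀ W ∈ S, IsIrreducible A W) ∧ S.Pairwise (· ⟂ ·)}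
    (fun c hc hchain => ⟨⋃₀ c, ⟨fun W ⟨s, hs, hW⟩ => (hc hs).1 W hW,
      (Set.pairwise_sUnion hchain.directedOn).2 fun s hs => (hc hs).2⟩,
      fun s hs => Set.subset_sUnion_of_mem hs⟩)
  refine ⟨S, hS, hpair, ?_⟩
  by_contra htop
  have hinv : IsInvariant A (sSup S) := by
    intro a ha w hw
    have hle : sSup S ≤ (sSup S).comap (a : H →ₗ[ℂ] H) :=
      sSup_le fun W hW w hw => (le_sSup hW : W ≤ sSup S) ((hS W hW).1 a ha w hw)
    exact hle hw
  obtain ⟨V, hV, hVirr⟩ := hinv.orthogonal.exists_irreducible_le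
    (fun h => htop (Submodule.orthogonal_eq_bot_iff.1 h))
  have hVorth : ∀ W ∈ S, W ⟂ V := fun W hW =>
    (Submodule.isOrtho_orthogonal_right (sSup S)).mono (le_sSup hW) hV
  have hmem : V ∈ S := by
    refine hmax (y := insert V S) ⟨?_, ?_⟩ (Set.subset_insert V S) (Set.mem_insert V S)
    · rintro W (rfl | hW)
      · exact hVirr
      · exact hS W hW
    · exact hpair.insert fun W hW _ => ⟨(hVorth W hW).symm, hVorth W hW⟩
  exact hVirr.2.1 (Submodule.isOrtho_self.1 (hVorth V hmem))

end Irreducible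

/-! ### Operators of the forms `M ⊗ 1` and `1 ⊗ N` in an adapted basis -/

section Blocks

variable {H : Type*} [NormedAddCommGroup H] [InnerProductSpace ℂ H]
  {n : ℕ} {ι κ : Fin n → Type*} [∀ α, Fintype (ι α)] [∀ α, Fintype (κ α)]
  (b : OrthonormalBasis (Σ α : Fin n, ι α × κ α) ℂ H)

/-- An operator whose matrix coefficients have the form `1 ⊗ N α` acts as `1 ⊗ N α`. -/
theorem apply_basis_of_inner {x : H →L[ℂ] H} (N : ∀ α, Matrix (κ α) (κ α) ℂ)
    (h0 : ∀ α i j β k l, (⟨β, k⟩ : Σ α, ι α) ≠ ⟨α, i⟩ →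
      ⟪b ⟨β, (k, l)⟩, x (b ⟨α, (i, j)⟩)⟫_ℂ = 0)
    (h1 : ∀ α i j l, ⟪b ⟨α, (i, l)⟩, x (b ⟨α, (i, j)⟩)⟫_ℂ = N α l j) (α : Fin n) (i : ι α)
    (j : κ α) : x (b ⟨α, (i, j)⟩) = ∑ l, N α l j • b ⟨α, (i, l)⟩ := by
  rw [← b.sum_repr' (x (b ⟨α, (i, j)⟩)), Fintype.sum_sigma, Finset.sum_eq_single α,
    Fintype.sum_prod_type, Finset.sum_eq_single i]
  · exact Finset.sum_congr rfl fun l _ => by rw [h1]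
  · intro k _ hk
    refine Finset.sum_eq_zero fun l _ => ?_
    rw [h0 _ _ _ _ _ _ (by simpa using hk), zero_smul]
  · simp
  · intro β _ hβ
    refine Finset.sum_eq_zero fun kl _ => ?_
    rw [h0 _ _ _ _ _ _ (fun h => hβ (congrArg Sigma.fst h)), zero_smul]
  · simp

/-- Operators of the forms `M α ⊗ 1` and `1 ⊗ N α` commute. -/
theorem commute_of_apply_basis {a x : H →L[ℂ] H} (M : ∀ α, Matrix (ι α) (ι α) ℂ)
    (N : ∀ α, Matrix (κ α) (κ α) ℂ)
    (ha : ∀ α i j, a (b ⟨α, (i, j)⟩) = ∑ k, M α k i • b ⟨α, (k, j)⟩)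
    (hx : ∀ α i j, x (b ⟨α, (i, j)⟩) = ∑ l, N α l j • b ⟨α, (i, l)⟩) : a * x = x * a := by
  have h : ((a * x : H →L[ℂ] H) : H →ₗ[ℂ] H) = ((x * a : H →L[ℂ] H) : H →ₗ[ℂ] H) := by
    refine b.toBasis.ext ?_
    rintro ⟨α, i, j⟩
    simp only [OrthonormalBasis.coe_toBasis]
    change a (x _) = x (a _)
    rw [hx, ha, map_sum, map_sum]
    simp_rw [map_smul, ha, hx, Finset.smul_sum]
    rw [Finset.sum_comm]
    exact Finset.sum_congr rfl fun k _ => Finset.sum_congr rfl fun l _ => smul_comm _ _ _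
  exact ContinuousLinearMap.coe_injective h

end Blocks

/-! ### Existence of sector decompositions -/

section Existence

variable {H : Type*} [NormedAddCommGroup H] [InnerProductSpace ℂ H] [CompleteSpace H]

theorem IsIntertwiner.comp {A : VonNeumannAlgebra H} {V W X : Submodule ℂ H} {S T : H →L[ℂ] H}
    (hS : IsIntertwiner A V W S) (hT : IsIntertwiner A W X T) : IsIntertwiner A V X (T * S) := by
  refine ⟨mul_mem hT.1 hS.1, fun v hv => hT.2.1 _ (hS.2.1 v hv), fun v hv v' hv' => ?_,
    fun w hw => ?_⟩
  · exact (hT.2.2.1 _ (hS.2.1 v hv) _ (hS.2.1 v' hv')).trans (hS.2.2.1 v hv v' hv')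
  · obtain ⟨u, hu, rfl⟩ := hT.2.2.2 w hw
    obtain ⟨v, hv, rfl⟩ := hS.2.2.2 u hu
    exact ⟨v, hv, rfl⟩

theorem IsIntertwiner.one (A : VonNeumannAlgebra H) (V : Submodule ℂ H) :
    IsIntertwiner A V V 1 :=
  ⟨one_mem _, fun _ h => h, fun _ _ _ _ => rfl, fun w hw => ⟨w, hw, rfl⟩⟩

variable [FiniteDimensional ℂ H]

/-- The structure theorem for von Neumann algebras on a finite-dimensional Hilbert space. -/
theorem nonempty_sectorDecomposition (A : VonNeumannAlgebra H) :
    Nonempty (SectorDecomposition A) := by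
  classical
  obtain ⟨S, hS, hpair, htop⟩ := exists_orthogonal_irreducibles A
  let W : S → Submodule ℂ H := Subtype.val
  have hW : ∀ s, IsIrreducible A (W s) := fun s => hS s s.2
  have hfam : OrthogonalFamily ℂ (fun s => W s) fun s => (W s).subtypeₗᵢ := by
    intro s t hst v w
    exact (Submodule.isOrtho_iff_inner_eq.1 (hpair s.2 t.2 (fun h => hst (Subtype.ext h))))
      v v.2 w w.2
  have : Finite S := WellFoundedGT.finite_of_iSupIndep hfam.independent fun s => (hW s).2.1
  -- Sectors are unitary equivalence classes of irreducibles: `L α` is a representative of the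
  -- class, and the members of the class index a basis of `R α`.
  let R : Setoid S := ⟨fun s t => ∃ U, IsIntertwiner A (W s) (W t) U,
    fun s => ⟨1, .one A _⟩, fun ⟨U, hU⟩ => hU.exists_symm (hW _) (hW _),
    fun ⟨U, hU⟩ ⟨T, hT⟩ => ⟨T * U, hU.comp hT⟩⟩
  let Q := Quotient R
  let e : Fin (Nat.card Q) ≃ Q := (Finite.equivFin Q).symm
  let r : Fin (Nat.card Q) → S := fun α => (e α).out
  have hr : ∀ α, (⟦r α⟧ : Q) = e α := fun α => Quotient.out_eq _
  let C : Fin (Nat.card Q) → Type _ := fun α => {s : S // (⟦s⟧ : Q) = e α}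
  let c : ∀ α, Fin (Nat.card (C α)) ≃ C α := fun α => (Finite.equivFin _).symm
  have hU : ∀ α, ∀ s : C α, ∃ U, IsIntertwiner A (W (r α)) (W s.1) U := fun α s =>
    Quotient.exact ((hr α).trans s.2.symm)
  choose U hU using hU
  let f : ∀ α, OrthonormalBasis (Fin (Module.finrank ℂ (W (r α)))) ℂ (W (r α)) :=
    fun α => stdOrthonormalBasis ℂ _
  -- Carrying one basis of the representative to every member of the class by intertwiners makes `A`
  -- act by the same matrix on all copies.
  let v : (Σ α, Fin (Module.finrank ℂ (W (r α))) × Fin (Nat.card (C α))) → H :=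
    fun x => U x.1 (c x.1 x.2.2) (f x.1 x.2.1)
  have horth : Orthonormal ℂ v := by
    rw [orthonormal_iff_ite]
    rintro ⟨α, a, j⟩ ⟨β, k, l⟩
    by_cases hst : (c α j).1 = (c β l).1
    · have hαβ : α = β := e.injective (by rw [← (c α j).2, hst, (c β l).2])
      subst hαβ
      have hjl : j = l := (c α).injective (Subtype.ext hst)
      subst hjl
      have h1 := (hU α (c α j)).2.2.1 _ (f α a).2 _ (f α k).2
      have h2 := orthonormal_iff_ite.1 (f α).orthonormal a k
      refine h1.trans (h2.trans ?_)
      simp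
    · rw [if_neg fun h => ?_]
      · exact Submodule.isOrtho_iff_inner_eq.1
          (hpair (c α j).1.2 (c β l).1.2 (fun h => hst (Subtype.ext h)))
          _ ((hU α (c α j)).2.1 _ (f α a).2) _ ((hU β (c β l)).2.1 _ (f β k).2)
      · rw [Sigma.mk.injEq] at h
        obtain ⟨rfl, h⟩ := h
        rw [heq_eq_eq, Prod.mk.injEq] at h
        exact hst (by rw [h.2])
  have hspan : ⊤ ≤ Submodule.span ℂ (Set.range v) := by
    rw [← htop]
    refine sSup_le fun V hV => ?_
    intro w hw
    let s : S := ⟨V, hV⟩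
    let α := e.symm ⟦s⟧
    let t : C α := ⟨s, (e.apply_symm_apply _).symm⟩
    obtain ⟨u, hu, rfl⟩ := (hU α t).2.2.2 w hw
    have hu' := congrArg Subtype.val ((f α).sum_repr ⟨u, hu⟩)
    rw [Submodule.coe_sum] at hu'
    simp only [Submodule.coe_smul] at hu'
    rw [← hu', map_sum]
    refine Submodule.sum_mem _ fun k _ => ?_
    rw [map_smul]
    refine Submodule.smul_mem _ _ (Submodule.subset_span ⟨⟨α, (k, (c α).symm t)⟩, ?_⟩)
    simp [v]
  let b := OrthonormalBasis.mk horth hspan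
  have hb : ∀ α a j, b ⟨α, (a, j)⟩ = U α (c α j) (f α a) := fun α a j => by
    simp [b, v]
  have hA : ∀ a ∈ A, ∀ α i j, a (b ⟨α, (i, j)⟩) =
      ∑ k, ⟪((f α k : W (r α)) : H), a (f α i)⟫_ℂ • b ⟨α, (k, j)⟩ := fun a ha α i j => by
    have h := congrArg Subtype.val
      ((f α).sum_repr' ⟨a (f α i), (hW (r α)).1 a ha _ (f α i).2⟩)
    rw [Submodule.coe_sum] at h
    simp only [Submodule.coe_smul, Submodule.coe_inner] at h
    simp_rw [hb]
    rw [commute_apply ha (hU α (c α j)).1]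
    conv_lhs => rw [← h]
    rw [map_sum]
    simp_rw [map_smul]
  -- Between two copies in one class `x` is scalar by Schur; between different classes a nonzero
  -- coefficient would produce an intertwiner.
  have hA' : ∀ x ∈ A.commutant, ∃ N : ∀ α, Matrix (Fin (Nat.card (C α))) (Fin (Nat.card (C α))) ℂ,
      ∀ α i j, x (b ⟨α, (i, j)⟩) = ∑ l, N α l j • b ⟨α, (i, l)⟩ := fun x hx => by
    have hmem : ∀ α j β l, (W (r β)).starProjection * (star (U β (c β l)) * (x * U α (c α j))) ∈
        A.commutant := fun α j β l => mul_mem (hW _).1.starProjection_mem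
          (mul_mem (star_mem (hU _ _).1) (mul_mem hx (hU _ _).1))
    have hcoef : ∀ α i j β k l, ⟪b ⟨β, (k, l)⟩, x (b ⟨α, (i, j)⟩)⟫_ℂ =
        ⟪((f β k : W (r β)) : H), ((W (r β)).starProjection *
          (star (U β (c β l)) * (x * U α (c α j)))) (f α i)⟫_ℂ := fun α i j β k l => by
      rw [hb, hb, ← ContinuousLinearMap.adjoint_inner_right]
      change _ = ⟪_, (W (r β)).starProjection _⟫_ℂ
      rw [← Submodule.inner_starProjection_left_eq_right,
        (Submodule.starProjection_eq_self_iff).2 (f β k).2]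
      rfl
    have hscal : ∀ α l j, ∃ z : ℂ, ∀ w ∈ W (r α), ((W (r α)).starProjection *
          (star (U α (c α l)) * (x * U α (c α j)))) w = z • w := fun α l j =>
      (hW (r α)).exists_scalar (hmem α j α l) fun w _ => Submodule.starProjection_apply_mem _ _
    choose N hN using hscal
    refine ⟨fun α => Matrix.of (N α), apply_basis_of_inner b _ ?_ ?_⟩
    · intro α i j β k l hne
      rw [hcoef]
      by_cases hαβ : β = α
      · subst hαβ
        rw [hN _ _ _ _ (f β i).2, inner_smul_right]
        have h2 : ⟪f β k, f β i⟫_ℂ = 0 :=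
          (f β).orthonormal.2 (fun h : k = i => hne (by rw [h]))
        rw [Submodule.coe_inner] at h2
        rw [h2, mul_zero]
      · by_contra h
        refine hαβ (e.injective ?_)
        rw [← hr α, ← hr β]
        obtain ⟨T, hT⟩ := (hW (r α)).exists_intertwiner (hW (r β))
          (mul_mem (star_mem (hU β (c β l)).1) (mul_mem hx (hU α (c α j)).1)) (f α i).2
          (fun h0 => h ((congrArg (fun z => ⟪((f β k : W (r β)) : H), z⟫_ℂ) h0).trans
            (inner_zero_right _)))
        exact (Quotient.sound ⟨T, hT⟩ : (⟦r α⟧ : Q) = ⟦r β⟧).symm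
    · intro α i j l
      rw [hcoef, hN _ _ _ _ (f α i).2, inner_smul_right]
      have h2 := inner_self_eq_one_of_norm_eq_one (𝕜 := ℂ) ((f α).orthonormal.1 i)
      rw [Submodule.coe_inner] at h2
      rw [h2, mul_one, Matrix.of_apply]
  refine ⟨⟨Nat.card Q, fun α => Module.finrank ℂ (W (r α)), fun α => Nat.card (C α), fun α => ?_,
    fun α => ?_, b, fun a => ⟨fun ha => ⟨_, hA a ha⟩, ?_⟩⟩⟩
  · have : Nontrivial (W (r α)) := Submodule.nontrivial_iff_ne_bot.2 (hW _).2.1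
    exact Module.finrank_pos
  · have : Nonempty (C α) := ⟨⟨r α, hr α⟩⟩
    exact Nat.card_pos
  · rintro ⟨M, hM⟩
    -- Every `M ⊗ 1` commutes with all `1 ⊗ N`, hence with the commutant, and so belongs to the
    -- double commutant.
    rw [← VonNeumannAlgebra.commutant_commutant A, VonNeumannAlgebra.mem_commutant_iff]
    intro x hx
    obtain ⟨N, hN⟩ := hA' x hx
    exact (commute_of_apply_basis b M N hM hN).symm

end Existence

/-! ### Expectation values -/

section Expect

variable {H : Type*} [NormedAddCommGroup H] [InnerProductSpace ℂ H]

theorem expect_add_left (ρ σ a : H →L[ℂ] H) : expect (ρ + σ) a = expect ρ a + expect σ a := by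
  simp [expect, add_mul]

theorem expect_sub_left (ρ σ a : H →L[ℂ] H) : expect (ρ - σ) a = expect ρ a - expect σ a := by
  simp [expect, sub_mul]

theorem expect_smul_left (c : ℂ) (ρ a : H →L[ℂ] H) : expect (c • ρ) a = c * expect ρ a := by
  simp [expect]

theorem expect_rankOne [FiniteDimensional ℂ H] (v w : H) (a : H →L[ℂ] H) :
    expect (InnerProductSpace.rankOne ℂ v w) a = ⟪w, a v⟫_ℂ := by
  rw [← InnerProductSpace.trace_rankOne, ← InnerProductSpace.comp_rankOne]
  exact LinearMap.trace_mul_comm ℂ _ _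

end Expect

/-! ### Reduced states, matrix units and the commutant -/

namespace SectorDecomposition

variable {H : Type*} [NormedAddCommGroup H] [InnerProductSpace ℂ H] [CompleteSpace H]
  {A : VonNeumannAlgebra H} (d : SectorDecomposition A)

theorem inner_basis_same (α : Fin d.n) (i k : Fin (d.dimL α)) (j l : Fin (d.dimR α)) :
    ⟪d.basis ⟨α, (i, j)⟩, d.basis ⟨α, (k, l)⟩⟫_ℂ = if i = k then if j = l then 1 else 0 else 0 := by
  rw [orthonormal_iff_ite.1 d.basis.orthonormal, ← ite_and]
  simp

theorem inner_basis_ne {α β : Fin d.n} (h : α ≠ β) (x y) :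
    ⟪d.basis ⟨α, x⟩, d.basis ⟨β, y⟩⟫_ℂ = 0 :=
  d.basis.orthonormal.2 fun h' => h (congrArg Sigma.fst h')

/-- The partial trace over `R α` of the block `α` of `ρ`. -/
noncomputable def redL (ρ : H →L[ℂ] H) (α : Fin d.n) :
    Matrix (Fin (d.dimL α)) (Fin (d.dimL α)) ℂ :=
  Matrix.of fun i k => ∑ j, ⟪d.basis ⟨α, (i, j)⟩, ρ (d.basis ⟨α, (k, j)⟩)⟫_ℂ

theorem reducedL_eq (ρ : H →L[ℂ] H) : d.reducedL ρ = Matrix.blockDiagonal' (d.redL ρ) := rfl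

theorem reducedL_inj {ρ σ : H →L[ℂ] H} : d.reducedL ρ = d.reducedL σ ↔ d.redL ρ = d.redL σ :=
  Matrix.blockDiagonal'_inj

theorem redL_add (ρ σ : H →L[ℂ] H) : d.redL (ρ + σ) = d.redL ρ + d.redL σ := by
  ext α i k
  simp [redL, Finset.sum_add_distrib]

theorem redL_smul (c : ℂ) (ρ : H →L[ℂ] H) : d.redL (c • ρ) = c • d.redL ρ := by
  ext α i k
  simp [redL, Finset.mul_sum]

theorem expect_eq_sum_trace (ρ : H →L[ℂ] H) {a : H →L[ℂ] H}
    {M : ∀ α, Matrix (Fin (d.dimL α)) (Fin (d.dimL α)) ℂ}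
    (hM : ∀ α i j, a (d.basis ⟨α, (i, j)⟩) = ∑ k, M α k i • d.basis ⟨α, (k, j)⟩) :
    expect ρ a = ∑ α, (d.redL ρ α * M α).trace := by
  rw [expect, LinearMap.trace_eq_sum_inner _ d.basis, Fintype.sum_sigma]
  refine Finset.sum_congr rfl fun α _ => ?_
  rw [Fintype.sum_prod_type, Matrix.trace]
  refine Finset.sum_congr rfl fun i _ => ?_
  rw [Matrix.diag_apply, Matrix.mul_apply]
  simp_rw [redL, Matrix.of_apply, Finset.sum_mul]
  rw [Finset.sum_comm]
  refine Finset.sum_congr rfl fun j _ => ?_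
  change ⟪_, ρ (a _)⟫_ℂ = _
  rw [hM, map_sum, inner_sum]
  refine Finset.sum_congr rfl fun k _ => ?_
  rw [map_smul, inner_smul_right, mul_comm]

theorem expect_eq_of_redL_eq {ρ σ : H →L[ℂ] H} (h : d.redL ρ = d.redL σ) {a : H →L[ℂ] H}
    (ha : a ∈ A) : expect ρ a = expect σ a := by
  obtain ⟨M, hM⟩ := (d.mem_iff a).1 ha
  rw [d.expect_eq_sum_trace ρ hM, d.expect_eq_sum_trace σ hM, h]

variable [FiniteDimensional ℂ H]

/-- The operator `⨁ α, M α ⊗ 1`. -/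
noncomputable def ofBlocks (M : ∀ α, Matrix (Fin (d.dimL α)) (Fin (d.dimL α)) ℂ) : H →L[ℂ] H :=
  LinearMap.toContinuousLinearMap
    (d.basis.toBasis.constr ℂ fun x => ∑ k, M x.1 k x.2.1 • d.basis ⟨x.1, (k, x.2.2)⟩)

theorem ofBlocks_basis (M : ∀ α, Matrix (Fin (d.dimL α)) (Fin (d.dimL α)) ℂ) (α : Fin d.n)
    (i : Fin (d.dimL α)) (j : Fin (d.dimR α)) :
    d.ofBlocks M (d.basis ⟨α, (i, j)⟩) = ∑ k, M α k i • d.basis ⟨α, (k, j)⟩ := by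
  rw [ofBlocks, LinearMap.coe_toContinuousLinearMap', ← OrthonormalBasis.coe_toBasis,
    Module.Basis.constr_basis]

theorem ofBlocks_mem (M : ∀ α, Matrix (Fin (d.dimL α)) (Fin (d.dimL α)) ℂ) : d.ofBlocks M ∈ A :=
  (d.mem_iff _).2 ⟨M, d.ofBlocks_basis M⟩

theorem star_ofBlocks (M : ∀ α, Matrix (Fin (d.dimL α)) (Fin (d.dimL α)) ℂ) :
    star (d.ofBlocks M) = d.ofBlocks fun α => (M α).conjTranspose := by
  refine ContinuousLinearMap.coe_injective ?_
  refine d.basis.toBasis.ext ?_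
  rintro ⟨α, i, j⟩
  refine InnerProductSpace.ext_inner_left_basis d.basis.toBasis ?_
  rintro ⟨β, k, l⟩
  simp only [OrthonormalBasis.coe_toBasis, ContinuousLinearMap.coe_coe,
    ContinuousLinearMap.star_eq_adjoint, ContinuousLinearMap.adjoint_inner_right, ofBlocks_basis,
    sum_inner, inner_sum, inner_smul_left, inner_smul_right]
  by_cases h : β = α
  · subst h
    simp [inner_basis_same]
  · simp [d.inner_basis_ne h]

/-- The matrix unit `|i⟩⟨k| ⊗ 1` of the sector `α`. -/
noncomputable def unit (α : Fin d.n) (i k : Fin (d.dimL α)) : H →L[ℂ] H :=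
  d.ofBlocks (Pi.single α (Matrix.single i k 1))

theorem unit_mem (α : Fin d.n) (i k : Fin (d.dimL α)) : d.unit α i k ∈ A := d.ofBlocks_mem _

theorem unit_basis_same (α : Fin d.n) (i k k' : Fin (d.dimL α)) (j : Fin (d.dimR α)) :
    d.unit α i k (d.basis ⟨α, (k', j)⟩) = if k = k' then d.basis ⟨α, (i, j)⟩ else 0 := by
  rw [unit, ofBlocks_basis]
  by_cases h : k = k'
  · simp [Matrix.single_apply, h, ite_smul]
  · simp [h]

theorem unit_basis_ne {α β : Fin d.n} (h : β ≠ α) (i k : Fin (d.dimL α)) (x) :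
    d.unit α i k (d.basis ⟨β, x⟩) = 0 := by
  obtain ⟨k', j⟩ := x
  rw [unit, ofBlocks_basis, Pi.single_eq_of_ne h]
  simp

theorem star_unit (α : Fin d.n) (i k : Fin (d.dimL α)) : star (d.unit α i k) = d.unit α k i := by
  rw [unit, star_ofBlocks, unit]
  congr 1
  ext1 β
  by_cases h : β = α
  · subst h; simp
  · simp [Pi.single_eq_of_ne h]

/-- With `expect_eq_of_redL_eq`, this shows that the reduced state carries the same information as
the expectation values on `A`. The order of the indices is reversed, as in `tr (ρ |k⟩⟨i|)`. -/
theorem redL_eq_expect (ρ : H →L[ℂ] H) (α : Fin d.n) (i k : Fin (d.dimL α)) :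
    d.redL ρ α i k = expect ρ (d.unit α k i) := by
  rw [unit, d.expect_eq_sum_trace ρ (d.ofBlocks_basis _), Finset.sum_eq_single α]
  · simp [Matrix.trace_mul_single]
  · intro β _ h
    simp [Pi.single_eq_of_ne h]
  · simp

/-- The commutant of `⨁ α, B(L α) ⊗ 1` is `⨁ α, 1 ⊗ B(R α)`. -/
theorem mem_commutant_iff (x : H →L[ℂ] H) : x ∈ A.commutant ↔
    ∃ N : ∀ α, Matrix (Fin (d.dimR α)) (Fin (d.dimR α)) ℂ,
      ∀ α i j, x (d.basis ⟨α, (i, j)⟩) = ∑ l, N α l j • d.basis ⟨α, (i, l)⟩ := by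
  constructor
  · intro hx
    refine ⟨fun α => Matrix.of fun l j => ⟪d.basis ⟨α, (⟨0, d.dimL_pos α⟩, l)⟩,
      x (d.basis ⟨α, (⟨0, d.dimL_pos α⟩, j)⟩)⟫_ℂ, ?_⟩
    -- Write `|i⟩|j⟩` as the matrix unit `|i⟩⟨0|` applied to `|0⟩|j⟩`, commute it past `x` and move
    -- it to the other side as its adjoint.
    have key : ∀ α i j β k l, ⟪d.basis ⟨β, (k, l)⟩, x (d.basis ⟨α, (i, j)⟩)⟫_ℂ =
        ⟪d.unit α ⟨0, d.dimL_pos α⟩ i (d.basis ⟨β, (k, l)⟩),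
          x (d.basis ⟨α, (⟨0, d.dimL_pos α⟩, j)⟩)⟫_ℂ := fun α i j β k l => by
      rw [← d.star_unit, ContinuousLinearMap.star_eq_adjoint,
        ContinuousLinearMap.adjoint_inner_left, commute_apply (d.unit_mem _ _ _) hx,
        unit_basis_same, if_pos rfl]
    refine apply_basis_of_inner d.basis _ ?_ ?_
    · intro α i j β k l hne
      rw [key]
      by_cases h : β = α
      · subst h
        rw [unit_basis_same, if_neg fun h => hne (by rw [h]), inner_zero_left]
      · rw [d.unit_basis_ne h, inner_zero_left]
    · intro α i j l
      rw [key, unit_basis_same, if_pos rfl]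
      rfl
  · rintro ⟨N, hN⟩
    rw [VonNeumannAlgebra.mem_commutant_iff]
    intro a ha
    obtain ⟨M, hM⟩ := (d.mem_iff a).1 ha
    exact commute_of_apply_basis d.basis M N hM hN

/-- The decomposition for the commutant, which acts on the other factors. -/
noncomputable abbrev swap : SectorDecomposition A.commutant where
  n := d.n
  dimL := d.dimR
  dimR := d.dimL
  dimL_pos := d.dimR_pos
  dimR_pos := d.dimL_pos
  basis := d.basis.reindex (Equiv.sigmaCongrRight fun _ => Equiv.prodComm _ _)
  mem_iff x := by
    have hb : ∀ α (i : Fin (d.dimL α)) (j : Fin (d.dimR α)),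
      (d.basis.reindex (Equiv.sigmaCongrRight fun _ => Equiv.prodComm _ _)) ⟨α, (j, i)⟩ =
        d.basis ⟨α, (i, j)⟩ := fun α i j => by
      rw [OrthonormalBasis.reindex_apply]; rfl
    simp_rw [hb, d.mem_commutant_iff x]
    exact exists_congr fun N => forall_congr' fun α => forall_comm

theorem swap_basis (α : Fin d.n) (i : Fin (d.dimL α)) (j : Fin (d.dimR α)) :
    d.swap.basis ⟨α, (j, i)⟩ = d.basis ⟨α, (i, j)⟩ := by
  rw [OrthonormalBasis.reindex_apply]; rfl

/-- This lets every statement about the commutant be obtained from the one about the algebra. -/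
theorem reducedL_swap (ρ : H →L[ℂ] H) : d.swap.reducedL ρ = d.reducedR ρ := by
  refine congrArg Matrix.blockDiagonal' (funext fun α => congrArg Matrix.of (funext fun j =>
    funext fun l => Finset.sum_congr rfl fun i _ => ?_))
  rw [swap_basis, swap_basis]

end SectorDecomposition

/-! ### Operators on the code space regarded as operators on `H` -/

section Extend

variable {H : Type*} [NormedAddCommGroup H] [InnerProductSpace ℂ H] [FiniteDimensional ℂ H]
  {K : Submodule ℂ H}

theorem extend_rankOne (v w : K) : extend (InnerProductSpace.rankOne ℂ v w) =
    InnerProductSpace.rankOne ℂ (v : H) (w : H) := by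
  ext x
  change ((InnerProductSpace.rankOne ℂ v w (K.orthogonalProjectionOnto x) : K) : H) = _
  rw [InnerProductSpace.rankOne_apply, InnerProductSpace.rankOne_apply, Submodule.coe_smul,
    Submodule.inner_orthogonalProjectionOnto_eq_of_mem_left]

theorem extend_add (ρ σ : K →L[ℂ] K) : extend (ρ + σ) = extend ρ + extend σ := by
  simp [extend, ContinuousLinearMap.comp_add, ContinuousLinearMap.add_comp]

theorem extend_smul (c : ℂ) (ρ : K →L[ℂ] K) : extend (c • ρ) = c • extend ρ := by
  simp [extend]

theorem extend_sub (ρ σ : K →L[ℂ] K) : extend (ρ - σ) = extend ρ - extend σ := by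
  simp [extend, ContinuousLinearMap.comp_sub, ContinuousLinearMap.sub_comp]

end Extend

/-! ### The bilinear criterion for recovery; positivity of reduced states -/

section Recovery

variable {H : Type*} [NormedAddCommGroup H] [InnerProductSpace ℂ H] [CompleteSpace H]
  [FiniteDimensional ℂ H] {K : Submodule ℂ H} {A : VonNeumannAlgebra K} {B : VonNeumannAlgebra H}

/-- An algebra `A` on `K` can be recovered from `B` if and only if the compressions to `K` of the
operators of the commutant of `B` commute with `A`. -/
theorem recoverable_iff : Recoverable A B ↔ ∀ x ∈ B.commutant, ∀ a ∈ A, ∀ φ ψ : K,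
    ⟪(φ : H), x (a ψ : K)⟫_ℂ = ⟪((star a φ : K) : H), x ψ⟫_ℂ := by
  constructor
  · intro h x hx a ha φ ψ
    obtain ⟨b, hb, hab⟩ := h a ha
    rw [(hab ψ).1, (hab φ).2, ← commute_apply hb hx, ContinuousLinearMap.star_eq_adjoint,
      ContinuousLinearMap.adjoint_inner_left]
  · intro h
    -- The recovering operator has to send `x ψ` to `x (a ψ)` for all `x` in the commutant of `B`.
    -- Formal combinations of pairs `(x, ψ)` express both sides before well-definedness is known.
    let Ψ : (K →L[ℂ] K) → (B.commutant × K →₀ ℂ) →ₗ[ℂ] H := fun a =>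
      Finsupp.linearCombination ℂ fun p => (p.1 : H →L[ℂ] H) ((a p.2 : K) : H)
    have hsingle : ∀ a (x : B.commutant) (ψ : K), Ψ a (Finsupp.single (x, ψ) 1) =
        (x : H →L[ℂ] H) ((a ψ : K) : H) := fun a x ψ => by
      simp [Ψ, Finsupp.linearCombination_single]
    have hterm : ∀ a ∈ A, ∀ b ∈ A, ∀ (x y : B.commutant) (φ ψ : K),
        ⟪(x : H →L[ℂ] H) ((a φ : K) : H), (y : H →L[ℂ] H) ((b ψ : K) : H)⟫_ℂ =
          ⟪(x : H →L[ℂ] H) φ, (y : H →L[ℂ] H) (((star a * b) ψ : K) : H)⟫_ℂ := by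
      intro a ha b _ x y φ ψ
      rw [← ContinuousLinearMap.adjoint_inner_right, ← ContinuousLinearMap.adjoint_inner_right]
      have := h (star (x : H →L[ℂ] H) * (y : H →L[ℂ] H)) (mul_mem (star_mem x.2) y.2) (star a)
        (star_mem ha) φ (b ψ)
      rw [star_star] at this
      exact this.symm
    have hinner : ∀ a ∈ A, ∀ b ∈ A, ∀ f g, ⟪Ψ a f, Ψ b g⟫_ℂ = ⟪Ψ 1 f, Ψ (star a * b) g⟫_ℂ := by
      intro a ha b hb f g
      simp only [Ψ, Finsupp.linearCombination_apply, Finsupp.sum_inner, Finsupp.inner_sum]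
      refine Finsupp.sum_congr fun p _ => ?_
      congr 1
      funext q c
      rw [inner_smul_left, inner_smul_right, inner_smul_left, inner_smul_right, hterm a ha b hb]
      rfl
    -- Well-definedness: `‖Ψ a f‖²` equals `⟨Ψ 1 f, Ψ (star a * a) f⟩`.
    have hker : ∀ a ∈ A, ∀ f, Ψ 1 f = 0 → Ψ a f = 0 := fun a ha f hf => by
      rw [← inner_self_eq_zero (𝕜 := ℂ), hinner a ha a ha, hf, inner_zero_left]
    let V := LinearMap.range (Ψ 1)
    obtain ⟨g, hg⟩ := LinearMap.exists_rightInverse_of_surjective (Ψ 1).rangeRestrict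
      (LinearMap.range_rangeRestrict _)
    -- The choice of the section `g` is immaterial for `a ∈ A`, by `hker`. Being zero on `Vᗮ` makes
    -- `b a` commute with the commutant of `B`, which preserves `V` and `Vᗮ`, and makes `b`
    -- compatible with adjoints.
    let b : (K →L[ℂ] K) → H →L[ℂ] H := fun a =>
      LinearMap.toContinuousLinearMap (Ψ a ∘ₗ g ∘ₗ (V.orthogonalProjectionOnto : H →ₗ[ℂ] V))
    have hb_range : ∀ a ∈ A, ∀ f, b a (Ψ 1 f) = Ψ a f := fun a ha f => by
      have h1 : b a (Ψ 1 f) = Ψ a (g ⟨Ψ 1 f, ⟨f, rfl⟩⟩) := by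
        change Ψ a (g (V.orthogonalProjectionOnto _)) = _
        rw [← Submodule.orthogonalProjectionOnto_mem_subspace_eq_self
          (⟨Ψ 1 f, ⟨f, rfl⟩⟩ : V)]
      rw [h1, ← sub_eq_zero, ← map_sub]
      refine hker a ha _ ?_
      rw [map_sub, sub_eq_zero]
      exact congrArg Subtype.val (LinearMap.congr_fun hg ⟨Ψ 1 f, ⟨f, rfl⟩⟩)
    have hb_orth : ∀ a, ∀ w ∈ Vᗮ, b a w = 0 := fun a w hw => by
      change Ψ a (g (V.orthogonalProjectionOnto w)) = 0
      rw [Submodule.orthogonalProjectionOnto_eq_zero_iff.2 hw, map_zero, map_zero]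
    have hdecomp : ∀ v : H, ∃ f, ∃ w ∈ Vᗮ, v = Ψ 1 f + w := fun v => by
      obtain ⟨f, hf⟩ := V.starProjection_apply_mem v
      exact ⟨f, _, V.sub_starProjection_mem_orthogonal v, by rw [hf]; abel⟩
    have hΨV : ∀ a f, Ψ a f ∈ V := fun a f => by
      refine Submodule.span_le.2 ?_ ((Finsupp.mem_span_range_iff_exists_finsupp).2 ⟨f, rfl⟩)
      rintro _ ⟨p, rfl⟩
      exact ⟨Finsupp.single (p.1, a p.2) 1, by rw [hsingle]; rfl⟩
    have hΨmap : ∀ a, ∀ y : B.commutant, ∀ f,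
        (y : H →L[ℂ] H) (Ψ a f) = Ψ a (f.mapDomain fun p => (y * p.1, p.2)) := fun a y f => by
      simp only [Ψ, Finsupp.linearCombination_mapDomain]
      simp only [Finsupp.linearCombination_apply, map_finsuppSum, map_smul]
      rfl
    have hyV : ∀ y : B.commutant, ∀ w ∈ Vᗮ, (y : H →L[ℂ] H) w ∈ Vᗮ := fun y w hw => by
      rw [Submodule.mem_orthogonal] at hw ⊢
      rintro _ ⟨f, rfl⟩
      rw [← ContinuousLinearMap.adjoint_inner_left]
      have := hΨmap 1 ⟨star (y : H →L[ℂ] H), star_mem y.2⟩ f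
      change star (y : H →L[ℂ] H) (Ψ 1 f) = _ at this
      rw [← ContinuousLinearMap.star_eq_adjoint, this]
      exact hw _ ⟨_, rfl⟩
    have hbB : ∀ a ∈ A, b a ∈ B := fun a ha => by
      rw [← VonNeumannAlgebra.commutant_commutant B, VonNeumannAlgebra.mem_commutant_iff]
      intro y hy
      ext v
      obtain ⟨f, w, hw, rfl⟩ := hdecomp v
      change y (b a _) = b a (y _)
      have h1 := hb_orth a _ (hyV ⟨y, hy⟩ w hw)
      have h2 := hΨmap 1 ⟨y, hy⟩ f
      have h3 := hΨmap a ⟨y, hy⟩ f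
      simp only at h1 h2 h3
      rw [map_add, map_add, map_add, map_add, hb_orth a w hw, hb_range a ha, h1, h2,
        hb_range a ha, h3, map_zero]
    have hstar : ∀ a ∈ A, star (b a) = b (star a) := fun a ha => by
      rw [ContinuousLinearMap.star_eq_adjoint]
      refine ((ContinuousLinearMap.eq_adjoint_iff _ _).2 fun u v => ?_).symm
      obtain ⟨f, u', hu', rfl⟩ := hdecomp u
      obtain ⟨k, v', hv', rfl⟩ := hdecomp v
      rw [map_add, map_add, hb_orth _ _ hu', hb_orth _ _ hv', hb_range _ ha,
        hb_range _ (star_mem ha), add_zero, add_zero, inner_add_left, inner_add_right,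
        (Submodule.mem_orthogonal' _ _).1 hu' _ (hΨV _ _),
        (Submodule.mem_orthogonal _ _).1 hv' _ (hΨV _ _), add_zero, add_zero,
        hinner _ (star_mem ha) 1 (one_mem _), star_star, mul_one]
    have hbψ : ∀ a ∈ A, ∀ ψ : K, b a ψ = ((a ψ : K) : H) := fun a ha ψ => by
      have h1 := hb_range a ha (Finsupp.single (1, ψ) 1)
      rw [hsingle, hsingle] at h1
      exact h1
    intro a ha
    exact ⟨b a, hbB a ha, fun ψ => ⟨(hbψ a ha ψ).symm,
      by rw [hstar a ha, hbψ _ (star_mem ha)]⟩⟩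

theorem IsPositive.extend {ρ : K →L[ℂ] K} (hρ : ρ.IsPositive) : (extend ρ).IsPositive := by
  have := hρ.conj_adjoint K.subtypeL
  rwa [Submodule.adjoint_subtypeL] at this

namespace SectorDecomposition

variable (d : SectorDecomposition B)

omit [FiniteDimensional ℂ H] in
theorem redL_star (ρ : H →L[ℂ] H) (α : Fin d.n) :
    d.redL (star ρ) α = (d.redL ρ α).conjTranspose := by
  ext i k
  simp only [redL, Matrix.of_apply, Matrix.conjTranspose_apply, star_sum]
  refine Finset.sum_congr rfl fun j _ => ?_
  rw [ContinuousLinearMap.star_eq_adjoint, ContinuousLinearMap.adjoint_inner_right]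
  exact (inner_conj_symm _ _).symm

omit [FiniteDimensional ℂ H] in
open scoped ComplexOrder in
theorem posSemidef_reducedL {ρ : H →L[ℂ] H} (hρ : ρ.IsPositive) : (d.reducedL ρ).PosSemidef := by
  refine Matrix.PosSemidef.of_dotProduct_mulVec_nonneg ?_ fun x => ?_
  · rw [Matrix.IsHermitian, reducedL_eq, Matrix.blockDiagonal'_conjTranspose]
    congr 1
    ext1 α
    rw [← redL_star, hρ.isSelfAdjoint.star_eq]
  · have h : star x ⬝ᵥ Matrix.mulVec (d.reducedL ρ) x =
        ∑ α, ∑ j, ⟪∑ i, x ⟨α, i⟩ • d.basis ⟨α, (i, j)⟩,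
          ρ (∑ i, x ⟨α, i⟩ • d.basis ⟨α, (i, j)⟩)⟫_ℂ := by
      simp only [dotProduct, Matrix.mulVec, Fintype.sum_sigma]
      refine Finset.sum_congr rfl fun α _ => ?_
      have h1 : ∀ i, ∑ β, ∑ k, d.reducedL ρ ⟨α, i⟩ ⟨β, k⟩ * x ⟨β, k⟩ =
          ∑ k, d.redL ρ α i k * x ⟨α, k⟩ := fun i => by
        rw [Finset.sum_eq_single α]
        · simp [reducedL_eq]
        · intro β _ hβ
          simp [reducedL_eq, Matrix.blockDiagonal'_apply_ne _ _ _ hβ.symm]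
        · simp
      simp_rw [h1, map_sum, map_smul, sum_inner, inner_sum, inner_smul_left, inner_smul_right]
      simp_rw [redL, Matrix.of_apply, Finset.sum_mul, Finset.mul_sum]
      conv_rhs => rw [Finset.sum_comm]
      refine Finset.sum_congr rfl fun i _ => ?_
      conv_rhs => rw [Finset.sum_comm]
      refine Finset.sum_congr rfl fun k _ => Finset.sum_congr rfl fun j _ => ?_
      rw [Pi.star_apply, RCLike.star_def]
      ring
    rw [h]
    exact Finset.sum_nonneg fun α _ => Finset.sum_nonneg fun j _ => hρ.inner_nonneg_right _

end SectorDecomposition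

end Recovery

/-! ### From the balance of entropies to complementary recovery -/

section Balance

variable {H : Type*} [NormedAddCommGroup H] [InnerProductSpace ℂ H] [CompleteSpace H]
  [FiniteDimensional ℂ H] {K : Submodule ℂ H} {Au : VonNeumannAlgebra H} {Ar : VonNeumannAlgebra K}

omit [FiniteDimensional ℂ H] in
theorem SectorDecomposition.expect_eq_zero (d : SectorDecomposition Au) {τ : H →L[ℂ] H}
    (h : d.redL τ = 0) {a : H →L[ℂ] H} (ha : a ∈ Au) : expect τ a = 0 := by
  have h0 : d.redL 0 = 0 := by simpa using d.redL_smul 0 0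
  rw [d.expect_eq_of_redL_eq (h.trans h0.symm) ha]
  simp [expect]

/-- Small self-adjoint traceless perturbations of the maximally mixed state are states. -/
theorem isDensity_mixed_add [Nontrivial H] {τ : H →L[ℂ] H} (hτ : IsSelfAdjoint τ)
    (htr : expect τ 1 = 0) {t : ℝ} (ht : 0 ≤ t) (hle : t * ‖τ‖ ≤ (Module.finrank ℂ H : ℝ)⁻¹) :
    IsDensity (((Module.finrank ℂ H : ℂ)⁻¹) • 1 + (t : ℂ) • τ) := by
  have hadj : star τ = τ := hτ
  have hn : (Module.finrank ℂ H : ℂ) ≠ 0 := by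
    exact_mod_cast (Module.finrank_pos (R := ℂ) (M := H)).ne'
  refine ⟨ContinuousLinearMap.isPositive_def.2 ⟨?_, fun x => ?_⟩, ?_⟩
  · intro x y
    have h1 : ⟪τ x, y⟫_ℂ = ⟪x, τ y⟫_ℂ := by
      rw [← ContinuousLinearMap.adjoint_inner_right, ← ContinuousLinearMap.star_eq_adjoint, hadj]
    simp only [ContinuousLinearMap.coe_coe, _root_.add_apply, _root_.smul_apply, inner_add_left,
      inner_add_right, inner_smul_left, inner_smul_right, one_apply_eq_self, h1, map_inv₀,
      map_natCast, Complex.conj_ofReal]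
  · have h1 : ContinuousLinearMap.reApplyInnerSelf
        (((Module.finrank ℂ H : ℂ)⁻¹) • 1 + (t : ℂ) • τ) x =
          (Module.finrank ℂ H : ℝ)⁻¹ * ‖x‖ ^ 2 + t * RCLike.re ⟪τ x, x⟫_ℂ := by
      have h2 : ((Module.finrank ℂ H : ℂ)⁻¹) = (((Module.finrank ℂ H : ℝ)⁻¹ : ℝ) : ℂ) := by
        push_cast; rfl
      rw [ContinuousLinearMap.reApplyInnerSelf_apply, h2]
      simp only [_root_.add_apply, _root_.smul_apply, inner_add_left, inner_smul_left,
        Complex.conj_ofReal, map_add]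
      simp only [RCLike.re_eq_complex_re, Complex.re_ofReal_mul]
      congr 2
      rw [one_apply_eq_self, inner_self_eq_norm_sq_to_K]
      norm_cast
    have h2 : |RCLike.re ⟪τ x, x⟫_ℂ| ≤ ‖τ‖ * ‖x‖ ^ 2 := by
      refine (RCLike.abs_re_le_norm _).trans ((norm_inner_le_norm _ _).trans ?_)
      rw [sq, ← mul_assoc]
      exact mul_le_mul_of_nonneg_right (τ.le_opNorm x) (norm_nonneg x)
    rw [h1]
    have h3 := (abs_le.1 h2).1
    have h4 := mul_le_mul_of_nonneg_right hle (sq_nonneg ‖x‖)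
    have h5 := mul_le_mul_of_nonneg_left h3 ht
    nlinarith
  · have h2 : LinearMap.trace ℂ H (τ : H →ₗ[ℂ] H) = 0 := by simpa [expect] using htr
    simp [h2, hn]

/-- The balance of entropies for the algebras themselves. -/
def BalanceL (dU : SectorDecomposition Au) (dR : SectorDecomposition Ar)
    (AUV : H →L[ℂ] H) (AIR : K →L[ℂ] K) : Prop :=
  ∀ ρ : K →L[ℂ] K, IsDensity ρ →
    expect (extend ρ) AUV + (entropy (dU.reducedL (extend ρ)) : ℂ) =
        expect ρ AIR + (entropy (dR.reducedL ρ) : ℂ)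

variable {dU : SectorDecomposition Au} {dR : SectorDecomposition Ar} {AUV : H →L[ℂ] H}
  {AIR : K →L[ℂ] K}

theorem entropyBalance_iff : EntropyBalance dU dR AUV AIR ↔
    BalanceL dU dR AUV AIR ∧ BalanceL dU.swap dR.swap AUV AIR := by
  simp only [EntropyBalance, BalanceL, SectorDecomposition.reducedL_swap]
  exact ⟨fun h => ⟨fun ρ hρ => (h ρ hρ).1, fun ρ hρ => (h ρ hρ).2⟩,
    fun h ρ hρ => ⟨h.1 ρ hρ, h.2 ρ hρ⟩⟩

/-- Along the segment from the maximally mixed state in direction `τ` the state `ρ_r` is fixed, so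
balance makes `S(ρ_u)` affine; strict concavity then leaves no room for `ρ_u` to move. -/
theorem BalanceL.redL_extend_eq_zero_of_isSelfAdjoint (h : BalanceL dU dR AUV AIR)
    {τ : K →L[ℂ] K} (hτ : IsSelfAdjoint τ) (h0 : dR.redL τ = 0) : dU.redL (extend τ) = 0 := by
  rcases subsingleton_or_nontrivial K with hK | hK
  · have : τ = 0 := by ext x; exact congrArg Subtype.val (Subsingleton.elim _ _)
    have h1 := dU.redL_smul 0 (extend τ)
    rw [← extend_smul] at h1
    simpa [this] using h1
  set n : ℂ := (Module.finrank ℂ K : ℂ)⁻¹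
  have hn : (0 : ℝ) < (Module.finrank ℂ K : ℝ)⁻¹ := by
    have := Module.finrank_pos (R := ℂ) (M := K)
    positivity
  -- A length short enough to keep `ρ t` positive; the `+ 1` covers `τ = 0`.
  set s : ℝ := (Module.finrank ℂ K : ℝ)⁻¹ / (‖τ‖ + 1) with hs
  have hs0 : 0 < s := by positivity
  have hsle : s * ‖τ‖ ≤ (Module.finrank ℂ K : ℝ)⁻¹ := by
    rw [hs, div_mul_eq_mul_div, div_le_iff₀ (by positivity)]
    nlinarith [norm_nonneg τ]
  let ρ : ℝ → K →L[ℂ] K := fun t => n • 1 + (t : ℂ) • τ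
  have hρ : ∀ t, 0 ≤ t → t ≤ s → IsDensity (ρ t) := fun t ht hts =>
    isDensity_mixed_add hτ (dR.expect_eq_zero h0 (one_mem _)) ht
      ((mul_le_mul_of_nonneg_right hts (norm_nonneg _)).trans hsle)
  have hR : ∀ t, dR.reducedL (ρ t) = dR.reducedL (n • 1) := fun t => by
    rw [SectorDecomposition.reducedL_inj, SectorDecomposition.redL_add,
      SectorDecomposition.redL_smul _ _ τ, h0, smul_zero, add_zero]
  have hlin : ∀ t, extend (ρ t) = extend (n • 1 : K →L[ℂ] K) + (t : ℂ) • extend τ := fun t => by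
    rw [extend_add, extend_smul _ τ]
  have hent : ∀ t, 0 ≤ t → t ≤ s → entropy (dU.reducedL (extend (ρ t))) =
      entropy (dR.reducedL (n • 1)) +
        (expect (n • 1 : K →L[ℂ] K) AIR - expect (extend (n • 1 : K →L[ℂ] K)) AUV).re +
        t * (expect τ AIR - expect (extend τ) AUV).re := fun t ht hts => by
    have h1 := congrArg Complex.re (h (ρ t) (hρ t ht hts))
    rw [hR, hlin, expect_add_left, expect_smul_left] at h1
    simp only [ρ, expect_add_left, expect_smul_left _ τ] at h1
    simp only [Complex.add_re, Complex.ofReal_re, Complex.re_ofReal_mul] at h1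
    simp only [Complex.sub_re]
    rw [hlin]
    linarith
  have hpos : ∀ t, 0 ≤ t → t ≤ s → (extend (ρ t)).IsPositive := fun t ht hts =>
    IsPositive.extend (hρ t ht hts).1
  have hmid : (1 / 2 : ℂ) • (dU.reducedL (extend (ρ 0)) + dU.reducedL (extend (ρ s))) =
      dU.reducedL (extend (ρ (s / 2))) := by
    simp only [SectorDecomposition.reducedL_eq, ← Matrix.blockDiagonal'_add,
      ← Matrix.blockDiagonal'_smul, hlin, SectorDecomposition.redL_add,
      SectorDecomposition.redL_smul]
    congr 1
    push_cast
    module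
  have key := eq_of_entropy_midpoint (dU.posSemidef_reducedL (hpos 0 le_rfl hs0.le))
    (dU.posSemidef_reducedL (hpos s hs0.le le_rfl)) (by
      rw [hmid, hent 0 le_rfl hs0.le, hent s hs0.le le_rfl, hent (s / 2) (by positivity)
        (by linarith)]
      ring)
  rw [SectorDecomposition.reducedL_inj, hlin, hlin, SectorDecomposition.redL_add,
    SectorDecomposition.redL_add, add_right_inj, SectorDecomposition.redL_smul,
    SectorDecomposition.redL_smul, Complex.ofReal_zero, zero_smul] at key
  exact (smul_eq_zero.1 key.symm).resolve_left (by exact_mod_cast hs0.ne')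

/-- Extension by complex linearity from the self-adjoint parts of `τ`, which are invisible to `Ar`
because `redL` respects adjoints. -/
theorem BalanceL.redL_extend_eq_zero (h : BalanceL dU dR AUV AIR)
    {τ : K →L[ℂ] K} (h0 : dR.redL τ = 0) : dU.redL (extend τ) = 0 := by
  have hstar : dR.redL (star τ) = 0 := by
    ext1 α
    rw [SectorDecomposition.redL_star, h0]
    simp
  have h1 := h.redL_extend_eq_zero_of_isSelfAdjoint (τ := τ + star τ)
    (IsSelfAdjoint.add_star_self τ)
    (by rw [SectorDecomposition.redL_add, h0, hstar, add_zero])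
  have h2 := h.redL_extend_eq_zero_of_isSelfAdjoint (τ := Complex.I • (τ + (-1 : ℂ) • star τ))
    (by
      have h2 : star (τ + (-1 : ℂ) • star τ) = star τ + (-1 : ℂ) • τ := by
        simp only [ContinuousLinearMap.star_eq_adjoint, map_add, map_smulₛₗ,
          ContinuousLinearMap.adjoint_adjoint, map_neg, map_one]
      rw [IsSelfAdjoint, star_smul, h2, RCLike.star_def, Complex.conj_I]
      module)
    (by
      rw [SectorDecomposition.redL_smul, SectorDecomposition.redL_add,
        SectorDecomposition.redL_smul, h0, hstar]
      simp)
  have h3 : τ = (1 / 2 : ℂ) • (τ + star τ) +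
      (-Complex.I / 2) • (Complex.I • (τ + (-1 : ℂ) • star τ)) := by
    rw [smul_smul, div_mul_eq_mul_div, neg_mul, Complex.I_mul_I]
    module
  rw [h3, extend_add, extend_smul, extend_smul _ (Complex.I • _), SectorDecomposition.redL_add,
    SectorDecomposition.redL_smul, SectorDecomposition.redL_smul, h1, h2]
  simp

/-- For `a` in the commutant of `Ar`, the operator `|aψ⟩⟨φ| - |ψ⟩⟨star a φ|` has zero expectation on
`Ar`, hence on `Au`. That vanishing is exactly the bilinear criterion, so balance for the algebras
yields recovery of the commutants. -/
theorem BalanceL.recoverable (h : BalanceL dU dR AUV AIR) :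
    Recoverable Ar.commutant Au.commutant := by
  rw [recoverable_iff, VonNeumannAlgebra.commutant_commutant]
  intro x hx a ha φ ψ
  set τ : K →L[ℂ] K := InnerProductSpace.rankOne ℂ (a ψ) φ -
    InnerProductSpace.rankOne ℂ ψ (star a φ) with hτ
  have h0 : dR.redL τ = 0 := by
    ext α i k
    rw [SectorDecomposition.redL_eq_expect, hτ, expect_sub_left, expect_rankOne, expect_rankOne,
      commute_apply (dR.unit_mem _ _ _) ha, ContinuousLinearMap.star_eq_adjoint,
      ContinuousLinearMap.adjoint_inner_left, sub_self]
    rfl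
  have h1 := dU.expect_eq_zero (h.redL_extend_eq_zero h0) hx
  rwa [hτ, extend_sub, extend_rankOne, extend_rankOne, expect_sub_left, expect_rankOne,
    expect_rankOne, sub_eq_zero] at h1

/-- The balance of entropies implies complementary recovery. -/
theorem EntropyBalance.complementaryRecovery (h : EntropyBalance dU dR AUV AIR) :
    ComplementaryRecovery Au Ar := by
  rw [entropyBalance_iff] at h
  refine ⟨?_, h.1.recoverable⟩
  have := h.2.recoverable
  rwa [VonNeumannAlgebra.commutant_commutant, VonNeumannAlgebra.commutant_commutant] at this

end Balance

/-! ### Factorization of vectors with Gram matrix `1 ⊗ N` -/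

section Gram

variable {E : Type*} [NormedAddCommGroup E] [InnerProductSpace ℂ E]
  {n : ℕ} {ι X : Fin n → Type*} [∀ μ, Fintype (X μ)]

/-- Vectors whose Gram matrix is of the form `⨁ μ, 1 ⊗ N μ` are of the form `|i⟩ ⊗ c μ x`. -/
theorem exists_orthonormal_of_gram (i₀ : ∀ μ, ι μ) (s : ∀ μ, ι μ → X μ → E)
    (h0 : ∀ μ i ν k x y, (⟨μ, i⟩ : Σ μ, ι μ) ≠ ⟨ν, k⟩ → ⟪s μ i x, s ν k y⟫_ℂ = 0)
    (h1 : ∀ μ i x y, ⟪s μ i x, s μ i y⟫_ℂ = ⟪s μ (i₀ μ) x, s μ (i₀ μ) y⟫_ℂ) :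
    ∃ (m : Fin n → ℕ) (o : (Σ μ, ι μ × Fin (m μ)) → E), Orthonormal ℂ o ∧
      ∃ c : ∀ μ, X μ → Fin (m μ) → ℂ, ∀ μ i x, s μ i x = ∑ k, c μ x k • o ⟨μ, (i, k)⟩ := by
  classical
  let T : ∀ μ, ι μ → (X μ → ℂ) →ₗ[ℂ] E := fun μ i => Fintype.linearCombination ℂ (s μ i)
  have hT : ∀ μ i u, T μ i u = ∑ x, u x • s μ i x := fun μ i u =>
    Fintype.linearCombination_apply ℂ (s μ i) u
  have hT0 : ∀ μ i ν k u v, (⟨μ, i⟩ : Σ μ, ι μ) ≠ ⟨ν, k⟩ → ⟪T μ i u, T ν k v⟫_ℂ = 0 := by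
    intro μ i ν k u v h
    simp only [hT, sum_inner, inner_sum, inner_smul_left, inner_smul_right, h0 μ i ν k _ _ h,
      mul_zero, Finset.sum_const_zero]
  have hT1 : ∀ μ i u v, ⟪T μ i u, T μ i v⟫_ℂ = ⟪T μ (i₀ μ) u, T μ (i₀ μ) v⟫_ℂ := by
    intro μ i u v
    simp only [hT, sum_inner, inner_sum, inner_smul_left, inner_smul_right, h1 μ i]
  let S : ∀ μ, Submodule ℂ E := fun μ => LinearMap.range (T μ (i₀ μ))
  let f : ∀ μ, OrthonormalBasis (Fin (Module.finrank ℂ (S μ))) ℂ (S μ) :=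
    fun μ => stdOrthonormalBasis ℂ _
  -- Coefficient vectors producing an orthonormal basis of the span for `i₀`; the same coefficients
  -- used at any other `i` again give orthonormal vectors, since the Gram matrices agree.
  choose C hC using fun μ k => (f μ k).2
  refine ⟨fun μ => Module.finrank ℂ (S μ), fun x => T x.1 x.2.1 (C x.1 x.2.2), ?_,
    fun μ x k => ⟪f μ k, ⟨s μ (i₀ μ) x, ⟨Pi.single x 1, by simp [T]⟩⟩⟫_ℂ, fun μ i x => ?_⟩
  · rw [orthonormal_iff_ite]
    rintro ⟨μ, i, k⟩ ⟨ν, j, l⟩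
    by_cases h : (⟨μ, i⟩ : Σ μ, ι μ) = ⟨ν, j⟩
    · obtain ⟨rfl, h⟩ := Sigma.mk.injEq .. ▸ h
      obtain rfl := eq_of_heq h
      simp only [hT1 μ i, hC]
      rw [← Submodule.coe_inner, orthonormal_iff_ite.1 (f μ).orthonormal]
      simp
    · rw [if_neg fun h' => h ?_]
      · exact hT0 _ _ _ _ _ _ h
      · rw [Sigma.mk.injEq] at h'
        obtain ⟨rfl, h'⟩ := h'
        rw [heq_eq_eq, Prod.mk.injEq] at h'
        rw [h'.1]
  · set c : Fin (Module.finrank ℂ (S μ)) → ℂ := fun k =>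
      ⟪f μ k, (⟨s μ (i₀ μ) x, ⟨Pi.single x 1, by simp [T]⟩⟩ : S μ)⟫_ℂ with hc
    have hs : s μ i x = T μ i (Pi.single x 1) := by simp [T]
    have hs0 : T μ (i₀ μ) (Pi.single x 1 - ∑ k, c k • C μ k) = 0 := by
      rw [map_sub, map_sum, sub_eq_zero]
      simp_rw [map_smul, hC]
      have h : ∑ k, c k • ((f μ k : S μ) : E) = s μ (i₀ μ) x := by
        have h := congrArg Subtype.val ((f μ).sum_repr'
          (⟨s μ (i₀ μ) x, ⟨Pi.single x 1, by simp [T]⟩⟩ : S μ))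
        rwa [Submodule.coe_sum] at h
      rw [h]
      simp [T]
    -- Equal Gram matrices give `T μ i` and `T μ (i₀ μ)` the same kernel, so the expansion found at
    -- `i₀` holds at `i`.
    have h2 : T μ i (Pi.single x 1 - ∑ k, c k • C μ k) = 0 := by
      rw [← inner_self_eq_zero (𝕜 := ℂ), hT1, hs0, inner_zero_left]
    rw [map_sub, map_sum, sub_eq_zero] at h2
    rw [hs, h2]
    simp_rw [map_smul]
    rfl

end Gram

/-! ### Product vectors and matrix elements of matrix units -/

namespace SectorDecomposition

variable {H : Type*} [NormedAddCommGroup H] [InnerProductSpace ℂ H] [CompleteSpace H]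
  {A : VonNeumannAlgebra H} (d : SectorDecomposition A)

theorem inner_basis_tmul (α : Fin d.n) (a : Fin (d.dimL α)) (b : Fin (d.dimR α))
    (v : EuclideanSpace ℂ (Fin (d.dimL α))) (w : EuclideanSpace ℂ (Fin (d.dimR α))) :
    ⟪d.basis ⟨α, (a, b)⟩, d.tmul α v w⟫_ℂ = v a * w b := by
  simp [tmul, inner_basis_same]

theorem inner_basis_tmul_ne {α β : Fin d.n} (h : α ≠ β) (x)
    (v : EuclideanSpace ℂ (Fin (d.dimL β))) (w : EuclideanSpace ℂ (Fin (d.dimR β))) :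
    ⟪d.basis ⟨α, x⟩, d.tmul β v w⟫_ℂ = 0 := by
  simp [tmul, d.inner_basis_ne h]

theorem inner_tmul (α : Fin d.n) (v v' : EuclideanSpace ℂ (Fin (d.dimL α)))
    (w w' : EuclideanSpace ℂ (Fin (d.dimR α))) :
    ⟪d.tmul α v w, d.tmul α v' w'⟫_ℂ = ⟪v, v'⟫_ℂ * ⟪w, w'⟫_ℂ := by
  rw [tmul]
  simp only [sum_inner, inner_smul_left, inner_basis_tmul, PiLp.inner_apply, Finset.sum_mul_sum]
  refine Finset.sum_congr rfl fun i _ => Finset.sum_congr rfl fun j _ => ?_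
  simp only [RCLike.inner_apply, map_mul]
  ring

theorem inner_tmul_ne {α β : Fin d.n} (h : α ≠ β) (v : EuclideanSpace ℂ (Fin (d.dimL α)))
    (w : EuclideanSpace ℂ (Fin (d.dimR α))) (v' : EuclideanSpace ℂ (Fin (d.dimL β)))
    (w' : EuclideanSpace ℂ (Fin (d.dimR β))) : ⟪d.tmul α v w, d.tmul β v' w'⟫_ℂ = 0 := by
  rw [tmul]
  simp only [sum_inner, inner_smul_left, d.inner_basis_tmul_ne h, mul_zero, Finset.sum_const_zero]

theorem norm_sum_tmul {κ κ' : Fin d.n → Type*} [∀ α, Fintype (κ α)] [∀ α, Fintype (κ' α)]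
    {u : ∀ α, κ α → EuclideanSpace ℂ (Fin (d.dimL α))} (hu : ∀ α, Orthonormal ℂ (u α))
    {w : ∀ α, κ' α → EuclideanSpace ℂ (Fin (d.dimR α))} (hw : ∀ α, Orthonormal ℂ (w α))
    (χ : EuclideanSpace ℂ (Σ α, κ α × κ' α)) :
    ‖∑ α, ∑ k, ∑ l, χ ⟨α, (k, l)⟩ • d.tmul α (u α k) (w α l)‖ = ‖χ‖ := by
  classical
  have ho : Orthonormal ℂ fun x : Σ α, κ α × κ' α => d.tmul x.1 (u x.1 x.2.1) (w x.1 x.2.2) := by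
    rw [orthonormal_iff_ite]
    rintro ⟨α, k, l⟩ ⟨β, k', l'⟩
    by_cases h : α = β
    · subst h
      rw [inner_tmul, orthonormal_iff_ite.1 (hu α), orthonormal_iff_ite.1 (hw α)]
      by_cases hk : k = k' <;> by_cases hl : l = l' <;> simp [hk, hl]
    · rw [d.inner_tmul_ne h, if_neg fun h' => h (congrArg Sigma.fst h')]
  have hsum : ∑ α, ∑ k, ∑ l, χ ⟨α, (k, l)⟩ • d.tmul α (u α k) (w α l) =
      ∑ x, χ x • d.tmul x.1 (u x.1 x.2.1) (w x.1 x.2.2) := by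
    rw [Fintype.sum_sigma]
    exact Finset.sum_congr rfl fun α _ => by rw [Fintype.sum_prod_type]
  have h2 : ‖∑ x, χ x • d.tmul x.1 (u x.1 x.2.1) (w x.1 x.2.2)‖ ^ 2 = ‖χ‖ ^ 2 := by
    rw [@norm_sq_eq_re_inner ℂ, @norm_sq_eq_re_inner ℂ _ _ _ _ χ, ho.inner_sum χ χ,
      PiLp.inner_apply]
    exact congrArg _ (Finset.sum_congr rfl fun x _ => by rw [RCLike.inner_apply, mul_comm])
  rw [hsum]
  exact (sq_eq_sq₀ (norm_nonneg _) (norm_nonneg _)).1 h2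

variable [FiniteDimensional ℂ H]

theorem unit_apply (α : Fin d.n) (i k : Fin (d.dimL α)) (v : H) :
    d.unit α i k v = ∑ j, ⟪d.basis ⟨α, (k, j)⟩, v⟫_ℂ • d.basis ⟨α, (i, j)⟩ := by
  conv_lhs => rw [← d.basis.sum_repr' v, map_sum, Fintype.sum_sigma]
  rw [Finset.sum_eq_single α]
  · rw [Fintype.sum_prod_type, Finset.sum_eq_single k]
    · simp [unit_basis_same]
    · intro k' _ h
      simp [unit_basis_same, h.symm]
    · simp
  · intro β _ h
    simp [d.unit_basis_ne h]
  · simp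

theorem inner_unit (α : Fin d.n) (i k : Fin (d.dimL α)) (v w : H) :
    ⟪v, d.unit α i k w⟫_ℂ = ∑ j, ⟪v, d.basis ⟨α, (i, j)⟩⟫_ℂ * ⟪d.basis ⟨α, (k, j)⟩, w⟫_ℂ := by
  rw [unit_apply, inner_sum]
  exact Finset.sum_congr rfl fun j _ => by rw [inner_smul_right, mul_comm]

end SectorDecomposition

/-! ### Constructing the code decomposition from complementary recovery -/

section Construction

variable {H : Type*} [NormedAddCommGroup H] [InnerProductSpace ℂ H] [CompleteSpace H]
  [FiniteDimensional ℂ H] {K : Submodule ℂ H} {Au : VonNeumannAlgebra H} {Ar : VonNeumannAlgebra K}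

/-- The partial inner product of `v` with the vector `|b⟩` of the factor `R α`. -/
noncomputable def SectorDecomposition.slice (d : SectorDecomposition Au) (α : Fin d.n)
    (b : Fin (d.dimR α)) (v : H) : EuclideanSpace ℂ (Fin (d.dimL α)) :=
  WithLp.toLp 2 fun a => ⟪d.basis ⟨α, (a, b)⟩, v⟫_ℂ

/-- Gram matrices of slices become matrix elements of operators in the commutant of `Au`, to which
the recovery criterion applies. -/
theorem SectorDecomposition.inner_slice (d : SectorDecomposition Au) (α : Fin d.n)
    (b b' : Fin (d.dimR α)) (v w : H) :
    ⟪d.slice α b v, d.slice α b' w⟫_ℂ = ⟪v, d.swap.unit α b b' w⟫_ℂ := by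
  rw [d.swap.inner_unit, PiLp.inner_apply]
  refine Finset.sum_congr rfl fun a _ => ?_
  rw [RCLike.inner_apply, swap_basis, swap_basis, mul_comm]
  simp only [slice]
  rw [inner_conj_symm]

/-- The compression of `x` commutes with the projection `|k⟩⟨k| ⊗ 1` in `Ar`. With `inner_eq_inner`,
which uses the off-diagonal matrix units, this is the form `1 ⊗ N` of that compression. -/
theorem Recoverable.inner_eq_zero (h : Recoverable Ar Au) (dR : SectorDecomposition Ar)
    {x : H →L[ℂ] H} (hx : x ∈ Au.commutant) {μ ν : Fin dR.n} {i : Fin (dR.dimL μ)}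
    {k : Fin (dR.dimL ν)} (hne : (⟨μ, i⟩ : Σ μ, Fin (dR.dimL μ)) ≠ ⟨ν, k⟩) (j l) :
    ⟪((dR.basis ⟨μ, (i, j)⟩ : K) : H), x (dR.basis ⟨ν, (k, l)⟩ : K)⟫_ℂ = 0 := by
  have h1 := recoverable_iff.1 h x hx (dR.unit ν k k) (dR.unit_mem _ _ _)
    (dR.basis ⟨μ, (i, j)⟩) (dR.basis ⟨ν, (k, l)⟩)
  rw [dR.unit_basis_same, if_pos rfl] at h1
  rw [h1, dR.star_unit]
  by_cases hμ : μ = ν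
  · subst hμ
    rw [dR.unit_basis_same, if_neg fun h => hne (by rw [h])]
    simp
  · rw [dR.unit_basis_ne hμ]
    simp

theorem Recoverable.inner_eq_inner (h : Recoverable Ar Au) (dR : SectorDecomposition Ar)
    {x : H →L[ℂ] H} (hx : x ∈ Au.commutant) {μ : Fin dR.n} (i i' : Fin (dR.dimL μ)) (j l) :
    ⟪((dR.basis ⟨μ, (i, j)⟩ : K) : H), x (dR.basis ⟨μ, (i, l)⟩ : K)⟫_ℂ =
      ⟪((dR.basis ⟨μ, (i', j)⟩ : K) : H), x (dR.basis ⟨μ, (i', l)⟩ : K)⟫_ℂ := by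
  have h1 := recoverable_iff.1 h x hx (dR.unit μ i i') (dR.unit_mem _ _ _)
    (dR.basis ⟨μ, (i, j)⟩) (dR.basis ⟨μ, (i', l)⟩)
  rwa [dR.star_unit, dR.unit_basis_same, if_pos rfl, dR.unit_basis_same, if_pos rfl] at h1

/-- Recovery of `Ar` factorizes the vectors of `K`, as seen from the factor `L α`. -/
theorem Recoverable.exists_factor (h : Recoverable Ar Au) (dU : SectorDecomposition Au)
    (dR : SectorDecomposition Ar) (α : Fin dU.n) :
    ∃ (m : Fin dR.n → ℕ) (o : (Σ μ, Fin (dR.dimL μ) × Fin (m μ)) →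
      EuclideanSpace ℂ (Fin (dU.dimL α))), Orthonormal ℂ o ∧
      ∃ c : ∀ μ, Fin (dR.dimR μ) × Fin (dU.dimR α) → Fin (m μ) → ℂ, ∀ μ i j a b,
        ⟪dU.basis ⟨α, (a, b)⟩, ((dR.basis ⟨μ, (i, j)⟩ : K) : H)⟫_ℂ =
          ∑ k, c μ (j, b) k * o ⟨μ, (i, k)⟩ a := by
  obtain ⟨m, o, ho, c, hc⟩ := exists_orthonormal_of_gram (fun μ => ⟨0, dR.dimL_pos μ⟩)
    (fun μ i (x : Fin (dR.dimR μ) × Fin (dU.dimR α)) =>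
      dU.slice α x.2 ((dR.basis ⟨μ, (i, x.1)⟩ : K) : H))
    (fun μ i ν k x y hne => by
      rw [dU.inner_slice]
      exact h.inner_eq_zero dR (dU.swap.unit_mem _ _ _) hne _ _)
    (fun μ i x y => by
      rw [dU.inner_slice, dU.inner_slice]
      exact h.inner_eq_inner dR (dU.swap.unit_mem _ _ _) _ _ _ _)
  refine ⟨m, o, ho, c, fun μ i j a b => ?_⟩
  have h1 := congrArg (fun v : EuclideanSpace ℂ (Fin (dU.dimL α)) => v a) (hc μ i (j, b))
  simpa [SectorDecomposition.slice] using h1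

theorem sum_conj_mul_of_orthonormal {ι κ : Type*} [Fintype κ] [DecidableEq ι]
    {u : ι → EuclideanSpace ℂ κ} (hu : Orthonormal ℂ u) (i j : ι) :
    ∑ a, star (u i a) * u j a = if i = j then 1 else 0 := by
  rw [← orthonormal_iff_ite.1 hu i j, PiLp.inner_apply]
  exact Finset.sum_congr rfl fun a _ => by rw [RCLike.inner_apply, mul_comm]; rfl

/-- Coefficients of an orthonormal expansion. -/
theorem sum_conj_mul_expansion {ι κ : Type*} [Fintype ι] [Fintype κ]
    {u : ι → EuclideanSpace ℂ κ} (hu : Orthonormal ℂ u) (c : ι → ℂ) (i : ι) :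
    ∑ a, star (u i a) * ∑ k, c k * u k a = c i := by
  classical
  simp_rw [Finset.mul_sum, mul_left_comm _ (c _)]
  rw [Finset.sum_comm]
  simp_rw [← Finset.mul_sum, sum_conj_mul_of_orthonormal hu]
  simp

theorem sum_comm_four {α β γ δ M : Type*} [Fintype α] [Fintype β] [Fintype γ] [Fintype δ]
    [AddCommMonoid M] (f : α → β → γ → δ → M) :
    ∑ a, ∑ b, ∑ c, ∑ d, f a b c d = ∑ c, ∑ d, ∑ a, ∑ b, f a b c d := by
  calc ∑ a, ∑ b, ∑ c, ∑ d, f a b c d = ∑ p : α × β, ∑ q : γ × δ, f p.1 p.2 q.1 q.2 := by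
        simp only [Fintype.sum_prod_type]
    _ = ∑ q : γ × δ, ∑ p : α × β, f p.1 p.2 q.1 q.2 := Finset.sum_comm
    _ = _ := by simp only [Fintype.sum_prod_type]

theorem ComplementaryRecovery.nonempty_codeDecomposition (h : ComplementaryRecovery Au Ar)
    (dU : SectorDecomposition Au) (dR : SectorDecomposition Ar) :
    Nonempty (CodeDecomposition dU dR) := by
  choose m o ho c hc using h.1.exists_factor dU dR
  choose m' o' ho' c' hswap using h.2.exists_factor dU.swap dR.swap
  have hc' : ∀ α μ i j a b, ⟪dU.basis ⟨α, (a, b)⟩, ((dR.basis ⟨μ, (i, j)⟩ : K) : H)⟫_ℂ =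
      ∑ l, c' α μ (i, a) l * o' α ⟨μ, (j, l)⟩ b := fun α μ i j a b => by
    rw [← hswap, dU.swap_basis, dR.swap_basis]
  have hoμ : ∀ α μ i, Orthonormal ℂ fun k => o α ⟨μ, (i, k)⟩ := fun α μ i =>
    (ho α).comp _ fun k k' hk => by simpa using hk
  have hoμ' : ∀ α μ j, Orthonormal ℂ fun l => o' α ⟨μ, (j, l)⟩ := fun α μ j =>
    (ho' α).comp _ fun k k' hk => by simpa using hk
  let Ψ : ∀ α μ, Fin (dR.dimL μ) → Fin (dR.dimR μ) → Fin (dU.dimL α) → Fin (dU.dimR α) → ℂ :=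
    fun α μ i j a b => ⟪dU.basis ⟨α, (a, b)⟩, ((dR.basis ⟨μ, (i, j)⟩ : K) : H)⟫_ℂ
  -- Coefficients of a code basis vector in the product of the two orthonormal families. The
  -- `L`-factorization shows that they do not depend on `i` (`hG`), the `R`-factorization that they
  -- do not depend on `j` (`hG'`).
  let G : ∀ α μ, Fin (dR.dimL μ) → Fin (dR.dimR μ) → Fin (m α μ) → Fin (m' α μ) → ℂ :=
    fun α μ i j k l => ∑ a, ∑ b, star (o α ⟨μ, (i, k)⟩ a) * star (o' α ⟨μ, (j, l)⟩ b) *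
      Ψ α μ i j a b
  have hG : ∀ α μ i j k l, G α μ i j k l = ∑ b, star (o' α ⟨μ, (j, l)⟩ b) * c α μ (j, b) k := by
    intro α μ i j k l
    simp only [G]
    rw [Finset.sum_comm]
    refine Finset.sum_congr rfl fun b _ => ?_
    rw [← sum_conj_mul_expansion (hoμ α μ i) (c α μ (j, b)) k, Finset.mul_sum]
    refine Finset.sum_congr rfl fun a _ => ?_
    simp only [Ψ, hc α μ i j a b]
    ring
  have hG' : ∀ α μ i j k l, G α μ i j k l = ∑ a, star (o α ⟨μ, (i, k)⟩ a) * c' α μ (i, a) l := by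
    intro α μ i j k l
    simp only [G]
    refine Finset.sum_congr rfl fun a _ => ?_
    rw [← sum_conj_mul_expansion (hoμ' α μ j) (c' α μ (i, a)) l, Finset.mul_sum]
    refine Finset.sum_congr rfl fun b _ => ?_
    simp only [Ψ, hc' α μ i j a b]
    ring
  have hGconst : ∀ α μ i j i' j' k l, G α μ i j k l = G α μ i' j' k l := fun α μ i j i' j' k l => by
    rw [hG, ← hG α μ i', hG', ← hG' α μ i' j']
  -- Nothing is lost in the product expansion: for fixed `b` the slice lies in the span of the `o`,
  -- and for fixed `a` in that of the `o'`.
  have hΨ : ∀ α μ i j a b, Ψ α μ i j a b =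
      ∑ k, ∑ l, G α μ i j k l * (o α ⟨μ, (i, k)⟩ a * o' α ⟨μ, (j, l)⟩ b) := by
    intro α μ i j a b
    have h1 : ∀ l, ∑ k, G α μ i j k l * o α ⟨μ, (i, k)⟩ a = c' α μ (i, a) l := fun l => by
      simp_rw [hG, Finset.sum_mul]
      rw [Finset.sum_comm, ← sum_conj_mul_expansion (hoμ' α μ j) (c' α μ (i, a)) l]
      refine Finset.sum_congr rfl fun b' _ => ?_
      simp_rw [mul_assoc, ← Finset.mul_sum]
      rw [← hc α μ i j a b', ← hc' α μ i j a b']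
    rw [Finset.sum_comm]
    simp_rw [← mul_assoc, ← Finset.sum_mul, h1]
    exact hc' α μ i j a b
  let i₀ : ∀ μ, Fin (dR.dimL μ) := fun μ => ⟨0, dR.dimL_pos μ⟩
  let j₀ : ∀ μ, Fin (dR.dimR μ) := fun μ => ⟨0, dR.dimR_pos μ⟩
  let χ : ∀ μ, EuclideanSpace ℂ (Σ α, Fin (m α μ) × Fin (m' α μ)) := fun μ =>
    WithLp.toLp 2 fun x => G x.1 μ (i₀ μ) (j₀ μ) x.2.1 x.2.2
  have hembed : ∀ μ i j, ((dR.basis ⟨μ, (i, j)⟩ : K) : H) =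
      ∑ α, ∑ k, ∑ l, χ μ ⟨α, (k, l)⟩ • dU.tmul α (o α ⟨μ, (i, k)⟩) (o' α ⟨μ, (j, l)⟩) := by
    intro μ i j
    rw [← dU.basis.sum_repr' ((dR.basis ⟨μ, (i, j)⟩ : K) : H), Fintype.sum_sigma]
    refine Finset.sum_congr rfl fun α _ => ?_
    simp only [SectorDecomposition.tmul, Finset.smul_sum, smul_smul, χ]
    rw [Fintype.sum_prod_type]
    have h2 : ∀ a b, ⟪dU.basis ⟨α, (a, b)⟩, ((dR.basis ⟨μ, (i, j)⟩ : K) : H)⟫_ℂ •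
        dU.basis ⟨α, (a, b)⟩ = ∑ k, ∑ l, (G α μ (i₀ μ) (j₀ μ) k l *
          (o α ⟨μ, (i, k)⟩ a * o' α ⟨μ, (j, l)⟩ b)) • dU.basis ⟨α, (a, b)⟩ := fun a b => by
      have := hΨ α μ i j a b
      simp_rw [hGconst α μ i j (i₀ μ) (j₀ μ)] at this
      simp_rw [← Finset.sum_smul]
      rw [← this]
    simp_rw [h2]
    exact sum_comm_four _
  refine ⟨⟨m, m', o, ho, o', ho', χ, fun μ => ?_, hembed⟩⟩
  rw [← dU.norm_sum_tmul (fun α => hoμ α μ (i₀ μ)) (fun α => hoμ' α μ (j₀ μ)) (χ μ), ← hembed]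
  exact dR.basis.orthonormal.1 _

end Construction

/-! ### Entropy and trace under isometric conjugation -/

section BlockEntropy

open Matrix

theorem entropy_blockDiagonal_conj {n : ℕ} {ι κ : Fin n → Type*} [∀ α, Fintype (ι α)]
    [∀ α, DecidableEq (ι α)] [∀ α, Fintype (κ α)] [∀ α, DecidableEq (κ α)]
    (W : ∀ α, Matrix (ι α) (κ α) ℂ) (hW : ∀ α, (W α)ᴴ * W α = 1) (d : ∀ α, κ α → ℝ) :
    entropy (blockDiagonal' fun α => W α * diagonal (fun i => (d α i : ℂ)) * (W α)ᴴ) =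
      ∑ α, ∑ i, Real.negMulLog (d α i) := by
  rw [blockDiagonal'_mul, blockDiagonal'_mul, ← blockDiagonal'_conjTranspose,
    blockDiagonal'_diagonal, entropy_isometry_conj (blockDiagonal' W) (by
      rw [blockDiagonal'_conjTranspose, ← blockDiagonal'_mul]
      simp_rw [hW]
      exact blockDiagonal'_one) (fun ik => d ik.1 ik.2), Fintype.sum_sigma]

theorem trace_isometry_conj {ι κ : Type*} [Fintype ι] [Fintype κ] [DecidableEq κ]
    (W : Matrix ι κ ℂ) (hW : Wᴴ * W = 1) (M : Matrix κ κ ℂ) : (W * M * Wᴴ).trace = M.trace := by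
  rw [Matrix.trace_mul_comm, ← Matrix.mul_assoc, hW, Matrix.one_mul]

end BlockEntropy

/-! ### Central operators are scalars on sectors -/

section Scalars

variable {H : Type*} [NormedAddCommGroup H] [InnerProductSpace ℂ H] [CompleteSpace H]
  {A : VonNeumannAlgebra H} (d : SectorDecomposition A)

namespace SectorDecomposition

/-- An operator acting by scalars on the sectors. -/
theorem expect_of_scalar (ρ : H →L[ℂ] H) {a : H →L[ℂ] H} {c : Fin d.n → ℂ}
    (ha : ∀ α x, a (d.basis ⟨α, x⟩) = c α • d.basis ⟨α, x⟩) :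
    expect ρ a = ∑ α, c α * (d.redL ρ α).trace := by
  rw [d.expect_eq_sum_trace ρ (M := fun α => c α • 1) (fun α i j => ?_)]
  · simp
  · simp [ha, Matrix.one_apply]

theorem blockScalar_basis (c : Fin d.n → ℂ) (α : Fin d.n) (x) :
    d.blockScalar c (d.basis ⟨α, x⟩) = c α • d.basis ⟨α, x⟩ := by
  classical
  rw [blockScalar, _root_.sum_apply, Finset.sum_eq_single ⟨α, x⟩]
  · simp [InnerProductSpace.rankOne_apply]
  · intro y _ hy
    rw [_root_.smul_apply, InnerProductSpace.rankOne_apply, d.basis.orthonormal.2 hy, zero_smul,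
      smul_zero]
  · simp

theorem isCentral_blockScalar (c : Fin d.n → ℂ) : IsCentral A (d.blockScalar c) := by
  refine ⟨(d.mem_iff _).2 ⟨fun α => c α • 1, fun α i j => ?_⟩, fun b hb => ?_⟩
  · simp [blockScalar_basis, Matrix.one_apply]
  · obtain ⟨M, hM⟩ := (d.mem_iff b).1 hb
    exact (commute_of_apply_basis d.basis M (fun α => c α • 1) hM fun α i j => by
      simp [blockScalar_basis, Matrix.one_apply]).symm

variable [FiniteDimensional ℂ H]

theorem apply_basis_of_isCentral {a : H →L[ℂ] H} (ha : IsCentral A a) (α : Fin d.n) (x) :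
    a (d.basis ⟨α, x⟩) = d.sectorValue a α • d.basis ⟨α, x⟩ := by
  obtain ⟨M, hM⟩ := (d.mem_iff a).1 ha.1
  have h : ∀ i j, a (d.basis ⟨α, (i, j)⟩) =
      M α ⟨0, d.dimL_pos α⟩ ⟨0, d.dimL_pos α⟩ • d.basis ⟨α, (i, j)⟩ := fun i j => by
    -- Commuting with `|i⟩⟨0| ⊗ 1` leaves only the coefficient `M α 0 0`, for every `i`.
    have h1 := congrArg (fun f : H →L[ℂ] H => f (d.basis ⟨α, (⟨0, d.dimL_pos α⟩, j)⟩))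
      (ha.2 _ (d.unit_mem α i ⟨0, d.dimL_pos α⟩))
    simp only [mul_apply_eq_comp] at h1
    rw [unit_basis_same, if_pos rfl] at h1
    rw [h1, hM, map_sum]
    simp [unit_basis_same]
  obtain ⟨i, j⟩ := x
  rw [h, sectorValue, h, inner_smul_right, inner_basis_same]
  simp

end SectorDecomposition

end Scalars

/-! ### Compression to the code space -/

section Compression

variable {H : Type*} [NormedAddCommGroup H] [InnerProductSpace ℂ H]
  [FiniteDimensional ℂ H] {K : Submodule ℂ H}

/-- The compression of an operator to the subspace `K`. -/
noncomputable def compress (K : Submodule ℂ H) (x : H →L[ℂ] H) : K →L[ℂ] K :=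
  K.orthogonalProjectionOnto ∘L x ∘L K.subtypeL

theorem inner_compress (x : H →L[ℂ] H) (φ ψ : K) :
    ⟪φ, compress K x ψ⟫_ℂ = ⟪(φ : H), x ψ⟫_ℂ :=
  Submodule.inner_orthogonalProjectionOnto_eq_of_mem_left _ _

theorem expect_extend (ρ : K →L[ℂ] K) (x : H →L[ℂ] H) :
    expect (extend ρ) x = expect ρ (compress K x) :=
  (LinearMap.trace_comp_comm' (K.subtypeL : K →ₗ[ℂ] H)
    (((ρ ∘L K.orthogonalProjectionOnto ∘L x : H →L[ℂ] K)) : H →ₗ[ℂ] K)).symm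

end Compression

/-! ### The reduced state of a code state -/

namespace CodeDecomposition

open Matrix
open scoped Kronecker

variable {H : Type*} [NormedAddCommGroup H] [InnerProductSpace ℂ H] [CompleteSpace H]
  [FiniteDimensional ℂ H] {K : Submodule ℂ H} {Au : VonNeumannAlgebra H} {Ar : VonNeumannAlgebra K}
  {dU : SectorDecomposition Au} {dR : SectorDecomposition Ar} (D : CodeDecomposition dU dR)

/-- The block `α` of the reduced state of `χ μ`. -/
noncomputable def χblock (α : Fin dU.n) (μ : Fin dR.n) :
    Matrix (Fin (D.dimO α μ)) (Fin (D.dimO α μ)) ℂ :=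
  of fun k k' => ∑ l, D.χ μ ⟨α, (k, l)⟩ * star (D.χ μ ⟨α, (k', l)⟩)

/-- The isometry `⨁ μ, L_μ ⊗ O_αμ → L_α`. -/
def isom (α : Fin dU.n) :
    Matrix (Fin (dU.dimL α)) (Σ μ, Fin (dR.dimL μ) × Fin (D.dimO α μ)) ℂ :=
  of fun a x => D.inL α x a

theorem isom_conjTranspose_mul (α : Fin dU.n) : (D.isom α)ᴴ * D.isom α = 1 := by
  ext x y
  rw [Matrix.mul_apply, Matrix.one_apply, ← sum_conj_mul_of_orthonormal (D.inL_orthonormal α) x y]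
  rfl

theorem inner_basis_embed (α : Fin dU.n) (a b) (μ : Fin dR.n) (i j) :
    ⟪dU.basis ⟨α, (a, b)⟩, ((dR.basis ⟨μ, (i, j)⟩ : K) : H)⟫_ℂ =
      ∑ k, ∑ l, D.χ μ ⟨α, (k, l)⟩ * (D.inL α ⟨μ, (i, k)⟩ a * D.inR α ⟨μ, (j, l)⟩ b) := by
  rw [D.embed, inner_sum, Finset.sum_eq_single α]
  · simp only [inner_sum, inner_smul_right, dU.inner_basis_tmul]
  · intro β _ h
    simp only [inner_sum, inner_smul_right, dU.inner_basis_tmul_ne h.symm, mul_zero,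
      Finset.sum_const_zero]
  · simp

theorem inner_unit_embed (α : Fin dU.n) (a c : Fin (dU.dimL α)) (μ ν : Fin dR.n) (i j i' j') :
    ⟪((dR.basis ⟨ν, (i', j')⟩ : K) : H), dU.unit α c a ((dR.basis ⟨μ, (i, j)⟩ : K) : H)⟫_ℂ =
      ∑ k', ∑ l', ∑ k, ∑ l, (star (D.χ ν ⟨α, (k', l')⟩) * D.χ μ ⟨α, (k, l)⟩) *
        (star (D.inL α ⟨ν, (i', k')⟩ c) * D.inL α ⟨μ, (i, k)⟩ a) *
          if (⟨ν, (j', l')⟩ : Σ μ, Fin (dR.dimR μ) × Fin (D.dimO' α μ)) = ⟨μ, (j, l)⟩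
            then 1 else 0 := by
  rw [dU.inner_unit]
  have h : ∀ b, ⟪((dR.basis ⟨ν, (i', j')⟩ : K) : H), dU.basis ⟨α, (c, b)⟩⟫_ℂ *
      ⟪dU.basis ⟨α, (a, b)⟩, ((dR.basis ⟨μ, (i, j)⟩ : K) : H)⟫_ℂ =
      ∑ k', ∑ l', ∑ k, ∑ l, (star (D.χ ν ⟨α, (k', l')⟩) * D.χ μ ⟨α, (k, l)⟩) *
        (star (D.inL α ⟨ν, (i', k')⟩ c) * D.inL α ⟨μ, (i, k)⟩ a) *
          (star (D.inR α ⟨ν, (j', l')⟩ b) * D.inR α ⟨μ, (j, l)⟩ b) := fun b => by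
    rw [← inner_conj_symm, D.inner_basis_embed, D.inner_basis_embed]
    simp only [map_sum, Finset.sum_mul]
    simp only [Finset.mul_sum]
    refine Finset.sum_congr rfl fun k' _ => Finset.sum_congr rfl fun l' _ => Finset.sum_congr rfl
      fun k _ => Finset.sum_congr rfl fun l _ => ?_
    simp only [map_mul, RCLike.star_def]
    ring
  simp_rw [h]
  rw [Finset.sum_comm]
  refine Finset.sum_congr rfl fun k' _ => ?_
  rw [Finset.sum_comm]
  refine Finset.sum_congr rfl fun l' _ => ?_
  rw [Finset.sum_comm]
  refine Finset.sum_congr rfl fun k _ => ?_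
  rw [Finset.sum_comm]
  refine Finset.sum_congr rfl fun l _ => ?_
  rw [← Finset.mul_sum, sum_conj_mul_of_orthonormal (D.inR_orthonormal α)]

theorem compress_unit_basis (α : Fin dU.n) (a c : Fin (dU.dimL α)) (μ : Fin dR.n) (i j) :
    compress K (dU.unit α c a) (dR.basis ⟨μ, (i, j)⟩) =
      ∑ i', (∑ k', ∑ k, D.χblock α μ k k' *
        (star (D.inL α ⟨μ, (i', k')⟩ c) * D.inL α ⟨μ, (i, k)⟩ a)) • dR.basis ⟨μ, (i', j)⟩ := by
  have h := apply_basis_of_inner dR.swap.basis (x := compress K (dU.unit α c a))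
    (fun μ => of fun i' i => ∑ k', ∑ k, D.χblock α μ k k' *
        (star (D.inL α ⟨μ, (i', k')⟩ c) * D.inL α ⟨μ, (i, k)⟩ a)) ?_ ?_ μ j i
  · simp only [dR.swap_basis] at h
    exact h
  · intro μ j i ν j' i' hne
    rw [dR.swap_basis, dR.swap_basis, inner_compress, D.inner_unit_embed]
    refine Finset.sum_eq_zero fun k' _ => Finset.sum_eq_zero fun l' _ => Finset.sum_eq_zero
      fun k _ => Finset.sum_eq_zero fun l _ => ?_
    rw [if_neg, mul_zero]
    intro h
    rw [Sigma.mk.injEq] at h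
    obtain ⟨rfl, h⟩ := h
    rw [heq_eq_eq, Prod.mk.injEq] at h
    exact hne (by rw [h.1])
  · intro μ j i i'
    rw [dR.swap_basis, dR.swap_basis, inner_compress, D.inner_unit_embed, of_apply]
    refine Finset.sum_congr rfl fun k' _ => ?_
    rw [Finset.sum_comm]
    refine Finset.sum_congr rfl fun k _ => ?_
    rw [χblock, of_apply, Finset.sum_mul]
    refine Finset.sum_congr rfl fun l _ => ?_
    rw [Finset.sum_eq_single l, if_pos rfl]
    · ring
    · intro l' _ hl
      rw [if_neg fun h => hl ?_, mul_zero]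
      rw [Sigma.mk.injEq, heq_eq_eq, Prod.mk.injEq] at h
      exact h.2.2.symm
    · simp

/-- The entries are expectations of matrix units of `Au`, whose compressions to `K` act only on the
factors `L_μ`, with weights from `χblock`: orthonormality of `inR` forces equal `μ` and `j` and
traces out `O'_αμ`. -/
theorem redL_extend (ρ : K →L[ℂ] K) (α : Fin dU.n) :
    dU.redL (extend ρ) α = D.isom α *
      blockDiagonal' (fun μ => dR.redL ρ μ ⊗ₖ D.χblock α μ) * (D.isom α)ᴴ := by
  ext a c
  rw [dU.redL_eq_expect, expect_extend, dR.expect_eq_sum_trace ρ (D.compress_unit_basis α a c)]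
  rw [Matrix.mul_apply, Fintype.sum_sigma]
  refine Finset.sum_congr rfl fun μ _ => ?_
  have h : ∀ i' k', (D.isom α *
      blockDiagonal' (fun μ => dR.redL ρ μ ⊗ₖ D.χblock α μ)) a ⟨μ, (i', k')⟩ =
        ∑ i, ∑ k, D.inL α ⟨μ, (i, k)⟩ a * (dR.redL ρ μ i i' * D.χblock α μ k k') :=
    fun i' k' => by
      rw [Matrix.mul_apply, Fintype.sum_sigma, Finset.sum_eq_single μ, Fintype.sum_prod_type]
      · refine Finset.sum_congr rfl fun i _ => Finset.sum_congr rfl fun k _ => ?_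
        rw [blockDiagonal'_apply_eq]
        rfl
      · intro ν _ hν
        refine Finset.sum_eq_zero fun x _ => ?_
        rw [blockDiagonal'_apply_ne _ _ _ hν, mul_zero]
      · simp
  rw [Fintype.sum_prod_type]
  simp_rw [h]
  change ∑ i, ∑ i', dR.redL ρ μ i i' * (∑ k', ∑ k, D.χblock α μ k k' *
    (star (D.inL α ⟨μ, (i', k')⟩ c) * D.inL α ⟨μ, (i, k)⟩ a)) = _
  simp_rw [Finset.mul_sum]
  rw [Finset.sum_comm]
  refine Finset.sum_congr rfl fun i' _ => ?_
  rw [Finset.sum_comm]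
  refine Finset.sum_congr rfl fun k' _ => ?_
  simp_rw [Finset.sum_mul]
  refine Finset.sum_congr rfl fun i _ => Finset.sum_congr rfl fun k _ => ?_
  rw [conjTranspose_apply, isom, of_apply]
  ring

end CodeDecomposition

/-! ### The area operator satisfies the balance of entropies -/

namespace CodeDecomposition

open Matrix
open scoped Kronecker

variable {H : Type*} [NormedAddCommGroup H] [InnerProductSpace ℂ H] [CompleteSpace H]
  [FiniteDimensional ℂ H] {K : Submodule ℂ H} {Au : VonNeumannAlgebra H} {Ar : VonNeumannAlgebra K}
  {dU : SectorDecomposition Au} {dR : SectorDecomposition Ar} (D : CodeDecomposition dU dR)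

/-- The matrix of the component of `χ μ` in `O_αμ ⊗ O'_αμ`. -/
def χmat (μ : Fin dR.n) (α : Fin dU.n) : Matrix (Fin (D.dimO α μ)) (Fin (D.dimO' α μ)) ℂ :=
  of fun k l => D.χ μ ⟨α, (k, l)⟩

theorem χblock_eq (α : Fin dU.n) (μ : Fin dR.n) :
    D.χblock α μ = D.χmat μ α * (D.χmat μ α)ᴴ := by
  ext k k'
  rw [Matrix.mul_apply]
  rfl

theorem isHermitian_χblock (α : Fin dU.n) (μ : Fin dR.n) : (D.χblock α μ).IsHermitian := by
  rw [χblock_eq]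
  exact isHermitian_mul_conjTranspose_self _

theorem sum_trace_χblock (μ : Fin dR.n) : ∑ α, (D.χblock α μ).trace = 1 := by
  have h := inner_self_eq_one_of_norm_eq_one (𝕜 := ℂ) (D.norm_χ μ)
  rw [PiLp.inner_apply, Fintype.sum_sigma] at h
  rw [← h]
  refine Finset.sum_congr rfl fun α _ => ?_
  rw [Fintype.sum_prod_type]
  exact Finset.sum_congr rfl fun k _ => rfl

theorem χExpect_eq (AUV : H →L[ℂ] H) (μ : Fin dR.n) :
    D.χExpect AUV μ = ∑ α, dU.sectorValue AUV α * (D.χblock α μ).trace := by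
  rw [χExpect, Fintype.sum_sigma]
  refine Finset.sum_congr rfl fun α _ => ?_
  rw [Fintype.sum_prod_type, Matrix.trace, Finset.mul_sum]
  refine Finset.sum_congr rfl fun k _ => ?_
  rw [diag_apply, χblock, of_apply, Finset.mul_sum]
  exact Finset.sum_congr rfl fun l _ => by ring

/-- The eigenvalues of `ρ_u` are, up to zeros, products `p q` of eigenvalues of `ρ_r^μ` and of the
blocks of `χ_o^μ`. With `η(x) = -x log x`, the identity `η(p q) = q η(p) + p η(q)` and `∑ q = 1` for
each `μ` give `S(ρ_u) = S(ρ_r) + ∑ μ, tr(ρ_r^μ) S(χ_o^μ)`; the traces give the `AUV` term likewise.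
-/
theorem balanceL_areaIR {AUV : H →L[ℂ] H} (hAUV : IsCentral Au AUV) :
    BalanceL dU dR AUV (D.areaIR AUV) := by
  intro ρ hρ
  have hherm : ∀ μ, (dR.redL ρ μ).IsHermitian := fun μ => by
    rw [IsHermitian, ← dR.redL_star, hρ.1.isSelfAdjoint.star_eq]
  choose U p hU _ hUp _ using fun μ => exists_eq_conj_diagonal (hherm μ)
  choose Y q hY _ hYq _ using fun α μ => exists_eq_conj_diagonal (D.isHermitian_χblock α μ)
  let W : ∀ α, Matrix (Fin (dU.dimL α)) (Σ μ, Fin (dR.dimL μ) × Fin (D.dimO α μ)) ℂ :=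
    fun α => D.isom α * blockDiagonal' fun μ => U μ ⊗ₖ Y α μ
  have hW : ∀ α, (W α)ᴴ * W α = 1 := fun α => by
    simp only [W]
    rw [conjTranspose_mul, Matrix.mul_assoc, ← Matrix.mul_assoc (D.isom α)ᴴ,
      D.isom_conjTranspose_mul, Matrix.one_mul, blockDiagonal'_conjTranspose, ← blockDiagonal'_mul]
    have : ∀ μ, (U μ ⊗ₖ Y α μ)ᴴ * (U μ ⊗ₖ Y α μ) = 1 := fun μ => by
      rw [conjTranspose_kronecker, ← mul_kronecker_mul, hU, hY, one_kronecker_one]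
    simp_rw [this]
    exact blockDiagonal'_one
  let r : ∀ α, (Σ μ, Fin (dR.dimL μ) × Fin (D.dimO α μ)) → ℝ :=
    fun α x => p x.1 x.2.1 * q α x.1 x.2.2
  have hred : ∀ α, dU.redL (extend ρ) α = W α * diagonal (fun x => (r α x : ℂ)) * (W α)ᴴ :=
    fun α => by
    have h1 : ∀ μ, dR.redL ρ μ ⊗ₖ D.χblock α μ = (U μ ⊗ₖ Y α μ) *
        diagonal (fun x : Fin (dR.dimL μ) × Fin (D.dimO α μ) => (r α ⟨μ, x⟩ : ℂ)) *
          (U μ ⊗ₖ Y α μ)ᴴ := fun μ => by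
      conv_lhs => rw [hUp μ, hYq α μ]
      rw [mul_kronecker_mul, mul_kronecker_mul, conjTranspose_kronecker,
        diagonal_kronecker_diagonal]
      simp [r]
    rw [D.redL_extend]
    simp_rw [h1]
    rw [blockDiagonal'_mul, blockDiagonal'_mul, ← blockDiagonal'_conjTranspose,
      blockDiagonal'_diagonal]
    simp only [W, conjTranspose_mul, Matrix.mul_assoc]
  have hS : entropy (dU.reducedL (extend ρ)) = ∑ α, ∑ x, Real.negMulLog (r α x) := by
    rw [dU.reducedL_eq, ← entropy_blockDiagonal_conj W hW]
    exact congrArg (fun M => entropy (blockDiagonal' M)) (funext hred)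
  have hSr : entropy (dR.reducedL ρ) = ∑ μ, ∑ i, Real.negMulLog (p μ i) := by
    rw [dR.reducedL_eq, ← entropy_blockDiagonal_conj U hU]
    exact congrArg (fun M => entropy (blockDiagonal' M)) (funext hUp)
  have hSo : ∀ μ, entropy (D.χo μ) = ∑ α, ∑ k, Real.negMulLog (q α μ k) := fun μ => by
    rw [← entropy_blockDiagonal_conj (fun α => Y α μ) (fun α => hY α μ)]
    exact congrArg (fun M => entropy (blockDiagonal' M)) (funext fun α => hYq α μ)
  have htr : ∀ α, (dU.redL (extend ρ) α).trace = ∑ x, (r α x : ℂ) := fun α => by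
    rw [hred, trace_isometry_conj _ (hW α), trace_diagonal]
  have htrR : ∀ μ, (dR.redL ρ μ).trace = ∑ i, (p μ i : ℂ) := fun μ => by
    rw [hUp, trace_isometry_conj _ (hU μ), trace_diagonal]
  have htrO : ∀ α μ, (D.χblock α μ).trace = ∑ k, (q α μ k : ℂ) := fun α μ => by
    rw [hYq, trace_isometry_conj _ (hY α μ), trace_diagonal]
  have hone : ∀ μ, ∑ α, ∑ k, (q α μ k : ℂ) = 1 := fun μ => by
    rw [← D.sum_trace_χblock μ]
    exact Finset.sum_congr rfl fun α _ => (htrO α μ).symm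
  rw [areaIR, dU.expect_of_scalar _ (dU.apply_basis_of_isCentral hAUV),
    dR.expect_of_scalar _ (dR.blockScalar_basis _), hS, hSr]
  simp_rw [htr, htrR, D.χExpect_eq, htrO, hSo]
  push_cast
  have h1 : ∀ α, ∑ x, ((Real.negMulLog (r α x) : ℝ) : ℂ) = ∑ μ,
      ((∑ k, (q α μ k : ℂ)) * ∑ i, ((Real.negMulLog (p μ i) : ℝ) : ℂ) +
        (∑ k, ((Real.negMulLog (q α μ k) : ℝ) : ℂ)) * ∑ i, (p μ i : ℂ)) := fun α => by
    rw [Fintype.sum_sigma]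
    refine Finset.sum_congr rfl fun μ _ => ?_
    rw [Fintype.sum_prod_type, Finset.sum_comm, Finset.sum_mul_sum, Finset.sum_mul_sum,
      ← Finset.sum_add_distrib]
    refine Finset.sum_congr rfl fun k _ => ?_
    rw [← Finset.sum_add_distrib]
    refine Finset.sum_congr rfl fun i _ => ?_
    simp only [r, Real.negMulLog_mul]
    push_cast
    ring
  have h2 : ∀ α, ∑ x, (r α x : ℂ) = ∑ μ, (∑ k, (q α μ k : ℂ)) * ∑ i, (p μ i : ℂ) := fun α => by
    rw [Fintype.sum_sigma]
    refine Finset.sum_congr rfl fun μ _ => ?_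
    rw [Fintype.sum_prod_type, Finset.sum_comm, Finset.sum_mul_sum]
    refine Finset.sum_congr rfl fun k _ => Finset.sum_congr rfl fun i _ => ?_
    simp only [r]
    push_cast
    ring
  simp_rw [h1, h2, Finset.mul_sum (Finset.univ : Finset (Fin dR.n))]
  rw [Finset.sum_comm, Finset.sum_comm (s := (Finset.univ : Finset (Fin dU.n))),
    ← Finset.sum_add_distrib, ← Finset.sum_add_distrib]
  refine Finset.sum_congr rfl fun μ _ => ?_
  rw [Finset.sum_add_distrib, ← Finset.sum_mul, hone, ← Finset.sum_mul]
  simp_rw [← mul_assoc]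
  rw [← Finset.sum_mul]
  ring

/-- The code decomposition for the commutants. -/
noncomputable abbrev swap : CodeDecomposition dU.swap dR.swap where
  dimO := D.dimO'
  dimO' := D.dimO
  inL := D.inR
  inL_orthonormal := D.inR_orthonormal
  inR := D.inL
  inR_orthonormal := D.inL_orthonormal
  χ μ := WithLp.toLp 2 fun x => D.χ μ ⟨x.1, (x.2.2, x.2.1)⟩
  norm_χ μ := by
    rw [← D.norm_χ μ, EuclideanSpace.norm_eq, EuclideanSpace.norm_eq]
    congr 1
    exact Equiv.sum_comp (Equiv.sigmaCongrRight fun α => Equiv.prodComm _ _)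
      fun x => ‖D.χ μ x‖ ^ 2
  embed μ j i := by
    rw [dR.swap_basis, D.embed]
    refine Finset.sum_congr rfl fun α _ => ?_
    rw [Finset.sum_comm]
    refine Finset.sum_congr rfl fun l _ => Finset.sum_congr rfl fun k _ => ?_
    congr 1
    rw [SectorDecomposition.tmul, SectorDecomposition.tmul, Finset.sum_comm]
    refine Finset.sum_congr rfl fun b _ => Finset.sum_congr rfl fun a _ => ?_
    rw [dU.swap_basis, mul_comm]

/-- With `X` the block matrix of `χ μ`, the two reductions are `X Xᴴ` and the transpose of `Xᴴ X`,
so their nonzero spectra agree. -/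
theorem entropy_χo_swap (μ : Fin dR.n) : entropy (D.swap.χo μ) = entropy (D.χo μ) := by
  have h1 : D.χo μ = blockDiagonal' (D.χmat μ) * (blockDiagonal' (D.χmat μ))ᴴ := by
    rw [blockDiagonal'_conjTranspose, ← blockDiagonal'_mul]
    exact congrArg blockDiagonal' (funext fun α => D.χblock_eq α μ)
  have h2 : D.swap.χo μ = ((blockDiagonal' (D.χmat μ))ᴴ * blockDiagonal' (D.χmat μ))ᵀ := by
    rw [blockDiagonal'_conjTranspose, ← blockDiagonal'_mul, blockDiagonal'_transpose]
    refine congrArg blockDiagonal' (funext fun α => ?_)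
    ext l l'
    rw [transpose_apply, Matrix.mul_apply, of_apply]
    exact Finset.sum_congr rfl fun k _ =>
      (mul_comm (star (D.χ μ ⟨α, (k, l')⟩)) (D.χ μ ⟨α, (k, l)⟩)).symm
  rw [h2, entropy_transpose (isHermitian_conjTranspose_mul_self _), h1]
  exact entropy_mul_comm _ _ (isHermitian_conjTranspose_mul_self _)
    (isHermitian_mul_conjTranspose_self _)

theorem sectorValue_swap (AUV : H →L[ℂ] H) (α : Fin dU.n) :
    dU.swap.sectorValue AUV α = dU.sectorValue AUV α := by
  rw [SectorDecomposition.sectorValue, SectorDecomposition.sectorValue, dU.swap_basis]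

theorem χExpect_swap (AUV : H →L[ℂ] H) (μ : Fin dR.n) :
    D.swap.χExpect AUV μ = D.χExpect AUV μ := by
  rw [χExpect, χExpect]
  simp_rw [sectorValue_swap]
  exact Equiv.sum_comp (Equiv.sigmaCongrRight fun α => Equiv.prodComm _ _)
    fun x => star (D.χ μ x) * dU.sectorValue AUV x.1 * D.χ μ x

theorem areaIR_swap (AUV : H →L[ℂ] H) : D.swap.areaIR AUV = D.areaIR AUV := by
  refine ContinuousLinearMap.coe_injective (dR.basis.toBasis.ext ?_)
  rintro ⟨μ, i, j⟩
  simp only [OrthonormalBasis.coe_toBasis, ContinuousLinearMap.coe_coe]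
  rw [areaIR, areaIR, dR.blockScalar_basis, ← dR.swap_basis, dR.swap.blockScalar_basis,
    entropy_χo_swap, χExpect_swap]

theorem entropyBalance_areaIR {AUV : H →L[ℂ] H} (hAUV : IsCentral Au AUV) :
    EntropyBalance dU dR AUV (D.areaIR AUV) := by
  refine entropyBalance_iff.2 ⟨D.balanceL_areaIR hAUV, ?_⟩
  rw [← areaIR_swap]
  -- An algebra and its commutant have the same center, so `AUV` is also central for the commutant.
  refine D.swap.balanceL_areaIR ⟨VonNeumannAlgebra.mem_commutant_iff.2
    fun b hb => (hAUV.2 b hb).symm, fun b hb => ?_⟩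
  exact VonNeumannAlgebra.mem_commutant_iff.1 hb AUV hAUV.1

end CodeDecomposition

/-! ### Uniqueness of the area operator -/

section Uniqueness

variable {H : Type*} [NormedAddCommGroup H] [InnerProductSpace ℂ H] [CompleteSpace H]
  [FiniteDimensional ℂ H]

omit [CompleteSpace H] in
/-- The expectation values in all states determine an operator. -/
theorem eq_of_expect_eq {a b : H →L[ℂ] H} (h : ∀ ρ, IsDensity ρ → expect ρ a = expect ρ b) :
    a = b := by
  have h1 : ∀ v : H, ‖v‖ = 1 → ⟪v, a v⟫_ℂ = ⟪v, b v⟫_ℂ := fun v hv => by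
    rw [← expect_rankOne, ← expect_rankOne]
    refine h _ ⟨InnerProductSpace.isPositive_rankOne_self v, ?_⟩
    rw [InnerProductSpace.trace_rankOne, inner_self_eq_one_of_norm_eq_one hv]
  have h2 : ∀ v : H, ⟪v, a v⟫_ℂ = ⟪v, b v⟫_ℂ := fun v => by
    by_cases hv : v = 0
    · simp [hv]
    · have hn : (‖v‖ : ℂ) ≠ 0 := by simpa using hv
      have h3 : v = (‖v‖ : ℂ) • ((‖v‖ : ℂ)⁻¹ • v) := by
        rw [smul_smul, mul_inv_cancel₀ hn, one_smul]
      have h4 := h1 ((‖v‖ : ℂ)⁻¹ • v) (by simp [norm_smul, hv])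
      rw [h3]
      simp only [map_smul _ (‖v‖ : ℂ), inner_smul_left _ _ (‖v‖ : ℂ),
        inner_smul_right _ _ (‖v‖ : ℂ), h4]
  -- Pure states give the quadratic form, which determines a complex operator by polarization.
  refine ContinuousLinearMap.coe_injective ((ext_inner_map _ _).1 fun v => ?_)
  rw [← inner_conj_symm, ← inner_conj_symm (𝕜 := ℂ) (((b : H →ₗ[ℂ] H)) v)]
  exact congrArg _ (h2 v)

variable {K : Submodule ℂ H} {Au : VonNeumannAlgebra H} {Ar : VonNeumannAlgebra K}
  {dU : SectorDecomposition Au} {dR : SectorDecomposition Ar} {AUV : H →L[ℂ] H}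

theorem EntropyBalance.unique {a b : K →L[ℂ] K} (ha : EntropyBalance dU dR AUV a)
    (hb : EntropyBalance dU dR AUV b) : a = b :=
  eq_of_expect_eq fun ρ hρ => add_right_cancel ((ha ρ hρ).1.symm.trans (hb ρ hρ).1)

end Uniqueness

end HolographicRG

/-! ### The main theorem -/

theorem mainTheorem2 {H : Type*} [NormedAddCommGroup H] [InnerProductSpace ℂ H] [CompleteSpace H]
    [FiniteDimensional ℂ H] (K : Submodule ℂ H)
    (Au : VonNeumannAlgebra H) (Ar : VonNeumannAlgebra K)
    (AUV : H →L[ℂ] H) (hAUV : HolographicRG.IsCentral Au AUV) :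
    Nonempty (HolographicRG.SectorDecomposition Au) ∧
    Nonempty (HolographicRG.SectorDecomposition Ar) ∧
    ∀ (dU : HolographicRG.SectorDecomposition Au) (dR : HolographicRG.SectorDecomposition Ar),
      (HolographicRG.ComplementaryRecovery Au Ar ↔
        ∃ AIR : K →L[ℂ] K, HolographicRG.IsCentral Ar AIR ∧
          HolographicRG.EntropyBalance dU dR AUV AIR) ∧
      (HolographicRG.ComplementaryRecovery Au Ar →
        Nonempty (HolographicRG.CodeDecomposition dU dR)) ∧
      ∀ (D : HolographicRG.CodeDecomposition dU dR) (AIR : K →L[ℂ] K),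
        (HolographicRG.IsCentral Ar AIR ∧ HolographicRG.EntropyBalance dU dR AUV AIR) ↔
          AIR = D.areaIR AUV := by
  have harea : ∀ (dU : HolographicRG.SectorDecomposition Au)
      (dR : HolographicRG.SectorDecomposition Ar) (D : HolographicRG.CodeDecomposition dU dR),
      HolographicRG.IsCentral Ar (D.areaIR AUV) ∧
        HolographicRG.EntropyBalance dU dR AUV (D.areaIR AUV) := fun dU dR D =>
    ⟨dR.isCentral_blockScalar _, D.entropyBalance_areaIR hAUV⟩
  refine ⟨HolographicRG.nonempty_sectorDecomposition Au,
    HolographicRG.nonempty_sectorDecomposition Ar, fun dU dR =>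
      ⟨⟨fun h => ?_, fun ⟨_, _, h⟩ => h.complementaryRecovery⟩,
        fun h => h.nonempty_codeDecomposition dU dR, fun D AIR => ⟨fun h => ?_, ?_⟩⟩⟩
  · obtain ⟨D⟩ := h.nonempty_codeDecomposition dU dR
    exact ⟨_, harea dU dR D⟩
  · exact h.2.unique (harea dU dR D).2
  · rintro rfl
    exact harea dU dR D
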